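/- Let $T$ be a complete first-order theory in a language $L$, and let $|T| = |L| + \aleph_0$. Let $\mathfrak C$ be a monster model of $T$: it is $\kappa$-saturated and strongly $\kappa$-homogeneous for a cardinal $\kappa$ that is larger than all cardinals under consideration (formally: larger than every cardinal of a fixed universe containing $L$, in which the ordinals below are taken). Let $A\subseteq \mathfrak C$ with $|A|<\kappa$, and let $p(x)$ be a (consistent) partial type over $A$ in a finite tuple $x$ of variables. For a set $q$ of formulas, $\mathrm{dom}(q)$ is the set of parameters occurring in $q$. *Dividing and forking.* A formula $\varphi(x,a)$ (with $\varphi(x,y)\in L$, $a$ a finite tuple) divides over $B$ if for some $k<\omega$ there are realizations $(c_i)_{i<\omega}$ of $\mathrm{tp}(a/B)$ such that $\{\varphi(x,c_i): i<\omega\}$ is $k$-inconsistent. A set of formulas forks over $B$ if it implies a finite disjunction of formulas each of which divides over $B$. *Dividing depth.* $DD(p)$ is the supremum of all ordinals $\alpha$ for which there are $L$-formulas $(\varphi_j(x,y_j))_{j<\alpha}$, numbers $(k_j)_{j<\alpha}$ and parameters $(a_{s,i}: s\in\omega^{<\alpha}, i<\omega)$ such that $\{\varphi_{|s|}(x,a_{s,i})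 : i<\omega\}$ is $k_{|s|}$-inconsistent for every $s\in\omega^{<\alpha}$, and $p(x)\cup\{\varphi_i(x,a_{f\restriction i,f(i)}) : i<\alpha\}$ is consistent for every $f:\alpha\to\omega$. One writes $DD(p)=\infty$ if these ordinals are unbounded. *Forking depth.* $FD(p,A)$ is the supremum (again $\infty$ if unbounded) of all ordinals $\alpha$ for which there is a forking sequence of depth $\alpha$ in $p$ over $A$: formulas $\varphi_i(x,y_i)\in L$ and finite tuples $a_i$ ($i<\alpha$) such that $p(x)\cup\{\varphi_i(x,a_i) : i<\alpha\}$ is consistent and each $\varphi_i(x,a_i)$ forks over $A\cup\{a_j : j<i\}$. *Forking chains.* A forking chain of complete types of depth $\alpha$ in $p$ over $A$ is a sequence $(p_i(x))_{i<\alpha}$ of complete types, each over a set of cardinality less than $\kappa$, such that $p\subseteq p_0$, $A\subseteq \mathrm{dom}(p_0)$, $p_0$ forks over $A$, and for $0<i<\alpha$ the type $p_i$ extends $p_{<i}=\bigcup_{j<i}p_j$ and forks over $\mathrm{dom}(p_{<i})$. *Simple types.* $p$ is simple if there are no $\varphi(x,y)\in L$, $k<\omega$ and parameters $(a_s : \emptyset\neq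 s\in\omega^{<\omega})$ such that $\{\varphi(x,a_{s^\frown i}) : i<\omega\}$ is $k$-inconsistent for every $s\in\omega^{<\omega}$ and $p(x)\cup\{\varphi(x,a_{f\restriction (j+1)}) : j<\omega\}$ is consistent for every $f:\omega\to\omega$. **Proposition 3.6.** The following are equivalent: 1. $DD(p)<\infty$ (equivalently, $p$ is simple); 2. there is no forking chain of complete types of depth $|T|^+$ in $p$ over $A$. Moreover, $FD(p,A)=\infty$ if and only if $DD(p)=\infty$. -/

import Mathlib

open FirstOrder Cardinal

universe u v w

namespace ForkingDepth

/-- Formulas in the variables `x₀, …, xₙ₋₁` with parameters in `M`: the variable `Sum.inl c` stands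
for the parameter `c`, the variable `Sum.inr i` for `xᵢ`. -/
abbrev PFormula (L : FirstOrder.Language.{u, v}) (M : Type w) (n : ℕ) :=
  L.Formula (M ⊕ Fin n)

section

variable {L : FirstOrder.Language.{u, v}} {M : Type w} {n m : ℕ}

open Classical in
/-- The parameters that occur in a formula. -/
def params (φ : PFormula L M n) : Set M :=
  {c | Sum.inl c ∈ φ.freeVarFinset}

/-- `dom p`: the parameters that occur in some formula of `p`. -/
def dom (p : Set (PFormula L M n)) : Set M :=
  {c | ∃ φ ∈ p, c ∈ params φ}

/-- The formula `φ(x, a)`, for an `L`-formula `φ(y, x)` (the variables `y` come first in the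
index type) and a tuple `a` of parameters. -/
def subst (φ : L.Formula (Fin m ⊕ Fin n)) (a : Fin m → M) : PFormula L M n :=
  φ.relabel (Sum.map a id)

variable [L.Structure M]

/-- The tuple `b` satisfies the formula `φ(x)` with parameters. -/
def Sat (φ : PFormula L M n) (b : Fin n → M) : Prop :=
  φ.Realize (Sum.elim id b)

/-- Consistency (with the elementary diagram of `M`), i.e. finite satisfiability in `M`. -/
def Consistent (p : Set (PFormula L M n)) : Prop :=
  ∀ s : Finset (PFormula L M n), (s : Set (PFormula L M n)) ⊆ p → ∃ b, ∀ φ ∈ s, Sat φ b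

/-- `p(x)` is a partial type over `A`. -/
def IsPartialType (A : Set M) (p : Set (PFormula L M n)) : Prop :=
  dom p ⊆ A ∧ Consistent p

/-- `p(x)` is a complete type over `A`. -/
def IsCompleteType (A : Set M) (p : Set (PFormula L M n)) : Prop :=
  IsPartialType A p ∧ ∀ φ : PFormula L M n, params φ ⊆ A → φ ∈ p ∨ φ.not ∈ p

/-- `tp(a/A) = tp(b/A)`. -/
def SameType (A : Set M) (a b : Fin m → M) : Prop :=
  ∀ φ : PFormula L M m, params φ ⊆ A → (Sat φ a ↔ Sat φ b)

variable (L M) in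
/-- `M` is a monster model, for the cardinal `κ`: it is `κ`-saturated and strongly
`κ`-homogeneous, and `κ` is so large that it exceeds all cardinals of the universe in which the
language and the ordinals (the possible depths) are taken. -/
structure IsMonster (κ : Cardinal.{w}) : Prop where
  large : ∀ c : Cardinal.{max u v}, Cardinal.lift.{w} c < Cardinal.lift.{max u v} κ
  saturated : ∀ A : Set M, #A < κ → ∀ p : Set (PFormula L M 1), IsPartialType A p →
    ∃ b, ∀ φ ∈ p, Sat φ b
  homogeneous : ∀ A : Set M, #A < κ → ∀ f : A → M,
    (∀ φ : L.Formula A, φ.Realize (fun a : A => (a : M)) ↔ φ.Realize f) →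
    ∃ g : M ≃[L] M, ∀ a : A, g a = f a

/-- The family `(ψᵢ(x) : i < ω)` is `k`-inconsistent: no `k` of its members (counted by their
indices) are simultaneously satisfiable. -/
def KInconsistent (k : ℕ) (ψ : ℕ → PFormula L M n) : Prop :=
  ∀ s : Finset ℕ, s.card = k → ¬ ∃ b, ∀ i ∈ s, Sat (ψ i) b

/-- The formula `ψ(x)` with parameters divides over `A`: it is `φ(x, a)` for an `L`-formula `φ` and
a tuple `a`, and there are realizations `(cᵢ : i < ω)` of `tp(a/A)` such that
`{φ(x, cᵢ) : i < ω}` is `k`-inconsistent for some `k`. -/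
def Divides (A : Set M) (ψ : PFormula L M n) : Prop :=
  ∃ (m : ℕ) (φ : L.Formula (Fin m ⊕ Fin n)) (a : Fin m → M), ψ = subst φ a ∧
    ∃ (k : ℕ) (c : ℕ → Fin m → M),
      (∀ i, SameType (L := L) A a (c i)) ∧ KInconsistent k (fun i => subst φ (c i))

/-- `q(x)` implies the disjunction of the finite set `D` of formulas; by compactness this is
implication from a finite part of `q`. -/
def Implies (q : Set (PFormula L M n)) (D : Finset (PFormula L M n)) : Prop :=
  ∃ s : Finset (PFormula L M n), (s : Set (PFormula L M n)) ⊆ q ∧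
    ∀ b, (∀ φ ∈ s, Sat φ b) → ∃ ψ ∈ D, Sat ψ b

/-- `q(x)` forks over `A`: it implies a finite disjunction of formulas that divide over `A`. -/
def Forks (A : Set M) (q : Set (PFormula L M n)) : Prop :=
  ∃ D : Finset (PFormula L M n), (∀ ψ ∈ D, Divides A ψ) ∧ Implies q D

/-- There is a tree of depth `α` in `p`: parameters `a β s i` for `s ∈ ω^β`, `β < α`, `i < ω`,
formulas `φ β` and numbers `k β` for `β < α`, such that siblings are `k β`-inconsistent and each
branch is consistent with `p`. (Values at `β ≥ α` are irrelevant; every `f : α → ω` is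
the restriction of some function on the ordinals.) -/
def HasTree (p : Set (PFormula L M n)) (α : Ordinal.{max u v}) : Prop :=
  ∃ (m : Ordinal.{max u v} → ℕ) (φ : ∀ β, L.Formula (Fin (m β) ⊕ Fin n))
    (k : Ordinal.{max u v} → ℕ)
    (a : ∀ β : Ordinal.{max u v}, (Set.Iio β → ℕ) → ℕ → Fin (m β) → M),
    (∀ β < α, ∀ s : Set.Iio β → ℕ, KInconsistent (k β) (fun i => subst (φ β) (a β s i))) ∧
    ∀ f : Ordinal.{max u v} → ℕ,
      Consistent (p ∪ {ψ | ∃ β < α, ψ = subst (φ β) (a β (fun j => f j) (f β))})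

/-- The dividing depth `DD(p)`: the supremum of the depths of the trees in `p`, where `⊤` is `∞`. -/
noncomputable def DD (p : Set (PFormula L M n)) : WithTop Ordinal.{max u v} :=
  sSup ((fun α : Ordinal.{max u v} => (α : WithTop Ordinal.{max u v})) '' {α | HasTree p α})

/-- There is a forking sequence of depth `α` in `p` over `A`: formulas `φᵢ(x, aᵢ)`, `i < α`, that
are together consistent with `p` and such that `φᵢ(x, aᵢ)` forks over `A ∪ {aⱼ : j < i}`. -/
def HasForkingSequence (p : Set (PFormula L M n)) (A : Set M) (α : Ordinal.{max u v}) : Prop :=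
  ∃ (m : Ordinal.{max u v} → ℕ) (φ : ∀ i, L.Formula (Fin (m i) ⊕ Fin n))
    (a : ∀ i, Fin (m i) → M),
    Consistent (p ∪ {ψ | ∃ i < α, ψ = subst (φ i) (a i)}) ∧
    ∀ i < α, Forks (A ∪ {c | ∃ j < i, c ∈ Set.range (a j)}) {subst (φ i) (a i)}

/-- The forking depth `FD(p, A)`: the supremum of the depths of the forking sequences in `p` over
`A`, where `⊤` is `∞`. -/
noncomputable def FD (p : Set (PFormula L M n)) (A : Set M) : WithTop Ordinal.{max u v} :=
  sSup ((fun α : Ordinal.{max u v} => (α : WithTop Ordinal.{max u v})) ''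
    {α | HasForkingSequence p A α})

/-- The union `q_{<i}` of the types `q j` with `j < i`. -/
def before (q : Ordinal.{max u v} → Set (PFormula L M n)) (i : Ordinal.{max u v}) :
    Set (PFormula L M n) :=
  {φ | ∃ j < i, φ ∈ q j}

/-- There is a forking chain of complete types of depth `α` in `p` over `A`: complete types `q i`,
`i < α`, over sets of cardinality less than `κ`, such that `p ⊆ q 0`, `A ⊆ dom (q 0)`, `q 0` forks
over `A`, and for `0 < i < α` the type `q i` extends `q_{<i}` and forks over the domain of
`q_{<i}`. -/
def HasForkingChain (κ : Cardinal.{w}) (p : Set (PFormula L M n)) (A : Set M)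
    (α : Ordinal.{max u v}) : Prop :=
  ∃ q : Ordinal.{max u v} → Set (PFormula L M n),
    (∀ i < α, ∃ B : Set M, #B < κ ∧ IsCompleteType B (q i)) ∧
    (0 < α → p ⊆ q 0 ∧ A ⊆ dom (q 0) ∧ Forks A (q 0)) ∧
    ∀ i < α, 0 < i → before q i ⊆ q i ∧ Forks (dom (before q i)) (q i)

/-- `p` is a simple type: no `L`-formula has the tree property with branches consistent with `p`.
Nodes of `ω^{<ω}` are finite lists, `s ++ [i]` is the `i`-th child of `s`, and the proper initial
segments of a branch `f` are the lists `f 0, …, f (j - 1)`. -/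
def IsSimpleType (p : Set (PFormula L M n)) : Prop :=
  ¬ ∃ (m : ℕ) (φ : L.Formula (Fin m ⊕ Fin n)) (k : ℕ) (a : List ℕ → Fin m → M),
    (∀ s : List ℕ, KInconsistent k (fun i => subst φ (a (s ++ [i])))) ∧
    ∀ f : ℕ → ℕ, Consistent (p ∪ {ψ | ∃ j : ℕ, ψ = subst φ (a ((List.range (j + 1)).map f))})

/-- The cardinality `|T| = |L| + ℵ₀` of a complete theory, i.e. the number of `L`-formulas. -/
noncomputable def cardTheory (_T : L.Theory) : Cardinal.{max u v} :=
  max ℵ₀ L.card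

end

end ForkingDepth

-- Everything passes through one finite rank. `TreeRank Δ N q` asks for an infinitely branching tree
-- of depth `N` inside `q`, built from patterns (a formula with a number `k`) in `Δ`. Failure of
-- simplicity, unbounded `DD`, unbounded `FD` and a forking chain of length `|T|⁺` are each
-- equivalent to the existence of a single pattern for which `p` has rank at least `N` for every
-- `N`.
--
-- From depth to rank: suppose that `q'` extends `q` and forks over a small set containing the
-- parameters of `q`. One of the dividing disjuncts can be added to `q'` without loss of rank, and
-- automorphisms carry it to its inconsistent conjugates, so `q` has rank one more than `q'`, with
-- respect to the finitely many patterns witnessing the forking (`IsMonster.exists_treeRank_succ`).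
-- There are at most `|T|` finite sets of patterns, so along a sequence of length `|T|⁺` one of them
-- recurs infinitely often, and the rank at the bottom is unbounded. A pigeonhole on patterns
-- (`TreeRank.exists_single`) leaves a single one. A tree of depth `|T|⁺`, as in `DD`, repeats one
-- pattern on infinitely many levels directly.
--
-- From rank to depth: compactness (`IsMonster.exists_of_fip`) turns unbounded rank into a pattern
-- tree on `ω^{<ω}`, which contradicts simplicity. Compactness again stretches this tree to any
-- ordinal depth (`IsPatternTree.hasTree`), or thins it to a forking sequence of any length
-- (`IsPatternTree.hasForkingSequence`). The types of one realization of such a sequence form a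
-- forking chain.

universe x

namespace ForkingDepth

open FirstOrder.Language

/-! ### Parameters of relabelled and substituted formulas -/

section Parameters

variable {L : FirstOrder.Language.{u, v}} {M : Type w}

theorem mem_varFinsetLeft_relabel {α β γ δ : Type*} [DecidableEq α] [DecidableEq β]
    (f : α → β) (h : α ⊕ γ → β ⊕ δ) (hl : ∀ a, h (Sum.inl a) = Sum.inl (f a))
    (hr : ∀ c, ∃ d, h (Sum.inr c) = Sum.inr d) (t : L.Term (α ⊕ γ)) :
    ∀ b ∈ (t.relabel h).varFinsetLeft, b ∈ Set.range f := by
  induction t with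
  | var x =>
    rcases x with a | c
    · simp [hl, Term.varFinsetLeft]
    · obtain ⟨d, hd⟩ := hr c
      simp [hd, Term.varFinsetLeft]
  | func F ts ih =>
    intro b hb
    simp only [Term.relabel, Term.varFinsetLeft, Finset.mem_biUnion] at hb
    obtain ⟨i, -, hi⟩ := hb
    exact ih i b hi

/-- Relabelling under a quantifier inserts a `castLE`; this carries the induction of
`mem_freeVarFinset_boundedRelabel` through that case. -/
theorem freeVarFinset_castLE {α : Type*} [DecidableEq α] {k l : ℕ} (h : k ≤ l)
    (φ : L.BoundedFormula α k) : ∀ b ∈ (φ.castLE h).freeVarFinset, b ∈ φ.freeVarFinset := by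
  have key : ∀ {k l : ℕ} (h : k ≤ l) (t : L.Term (α ⊕ Fin k)),
      (t.relabel (Sum.map id (Fin.castLE h))).varFinsetLeft = t.varFinsetLeft := by
    intro k l h t
    induction t with
    | var x => rcases x with a | c <;> simp [Term.varFinsetLeft]
    | func F ts ih => simp [Term.varFinsetLeft, ih]
  induction φ generalizing l with
  | falsum => simp [BoundedFormula.castLE, BoundedFormula.freeVarFinset]
  | equal t₁ t₂ => simp [BoundedFormula.castLE, BoundedFormula.freeVarFinset, key]
  | rel R ts => simp [BoundedFormula.castLE, BoundedFormula.freeVarFinset, key]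
  | imp f g hf hg =>
    intro b hb
    simp only [BoundedFormula.castLE, BoundedFormula.freeVarFinset, Finset.mem_union] at hb ⊢
    exact hb.imp (hf h b) (hg h b)
  | all f hf =>
    intro b hb
    exact hf _ b hb

theorem mem_freeVarFinset_boundedRelabel {α β : Type*} [DecidableEq α] [DecidableEq β]
    {j : ℕ} (f : α → β) {k : ℕ} (φ : L.BoundedFormula α k) :
    ∀ b ∈ (φ.relabel (n := j) (Sum.inl ∘ f)).freeVarFinset, b ∈ Set.range f := by
  have key : ∀ {k : ℕ} (t : L.Term (α ⊕ Fin k)),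
      ∀ b ∈ (t.relabel (BoundedFormula.relabelAux (n := j) (Sum.inl ∘ f) k)).varFinsetLeft,
        b ∈ Set.range f := fun t =>
    mem_varFinsetLeft_relabel f _ (fun a => by simp [BoundedFormula.relabelAux])
      (fun c => by simp [BoundedFormula.relabelAux]) t
  induction φ with
  | falsum => simp [BoundedFormula.freeVarFinset]
  | equal t₁ t₂ =>
    intro b hb
    simp only [BoundedFormula.relabel, BoundedFormula.mapTermRel, BoundedFormula.freeVarFinset,
      Finset.mem_union] at hb
    exact hb.elim (key t₁ b) (key t₂ b)
  | rel R ts =>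
    intro b hb
    simp only [BoundedFormula.relabel, BoundedFormula.mapTermRel, BoundedFormula.freeVarFinset,
      Finset.mem_biUnion] at hb
    obtain ⟨i, -, hi⟩ := hb
    exact key (ts i) b hi
  | imp f g hf hg =>
    intro b hb
    simp only [BoundedFormula.relabel_imp, BoundedFormula.freeVarFinset, Finset.mem_union] at hb
    exact hb.elim (hf b) (hg b)
  | all f hf =>
    intro b hb
    exact hf b (freeVarFinset_castLE _ _ b hb)

theorem mem_freeVarFinset_relabel {α β : Type*} [DecidableEq α] [DecidableEq β]
    (f : α → β) (φ : L.Formula α) : ∀ b ∈ (φ.relabel f).freeVarFinset, b ∈ Set.range f :=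
  mem_freeVarFinset_boundedRelabel f φ

theorem params_relabel_subset {n : ℕ} {α : Type*} (f : α → M ⊕ Fin n) (φ : L.Formula α) :
    params (φ.relabel f : PFormula L M n) ⊆ {c | Sum.inl c ∈ Set.range f} := by
  classical
  intro c hc
  exact mem_freeVarFinset_relabel f φ _ hc

theorem params_subst_subset {n m : ℕ} (φ : L.Formula (Fin m ⊕ Fin n)) (a : Fin m → M) :
    params (subst φ a) ⊆ Set.range a := by
  intro c hc
  obtain ⟨x, hx⟩ := params_relabel_subset _ _ hc
  rcases x with j | i
  · exact ⟨j, Sum.inl_injective hx⟩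
  · exact absurd hx (by simp)

theorem dom_mono {n : ℕ} {q q' : Set (PFormula L M n)} (h : q ⊆ q') : dom q ⊆ dom q' :=
  fun _ ⟨φ, hφ, hc⟩ => ⟨φ, h hφ, hc⟩

theorem params_subset_dom {n : ℕ} {q : Set (PFormula L M n)} {φ : PFormula L M n} (h : φ ∈ q) :
    params φ ⊆ dom q :=
  fun _ hc => ⟨φ, h, hc⟩

theorem subset_before {n : ℕ} {q : Ordinal.{max u v} → Set (PFormula L M n)} {i j : Ordinal.{max u v}}
    (h : j < i) : q j ⊆ before q i :=
  fun _ hψ => ⟨j, h, hψ⟩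

end Parameters

/-! ### Automorphisms, and formulas with parameters as definable sets -/

section Semantics

variable {L : FirstOrder.Language.{u, v}} {M : Type w} [L.Structure M] {n m : ℕ}

theorem realize_congr_freeVar {α : Type*} [DecidableEq α] (φ : L.Formula α) {v v' : α → M}
    (h : ∀ x ∈ φ.freeVarFinset, v x = v' x) : φ.Realize v ↔ φ.Realize v' :=
  (BoundedFormula.realize_restrictFreeVar (f := id) (v := fun x : φ.freeVarFinset => v x) v
    fun _ => rfl).symm.trans
    (BoundedFormula.realize_restrictFreeVar (f := id) v' fun x => h x x.2)

theorem sat_subst {φ : L.Formula (Fin m ⊕ Fin n)} {a : Fin m → M} {b : Fin n → M} :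
    Sat (subst φ a) b ↔ φ.Realize (Sum.elim a b) := by
  rw [Sat, subst, Formula.realize_relabel, Sum.elim_comp_map]
  simp

@[simp] theorem sat_not {φ : PFormula L M n} {b : Fin n → M} : Sat φ.not b ↔ ¬ Sat φ b :=
  Formula.realize_not

theorem sat_subst_equiv (σ : M ≃[L] M) {φ : L.Formula (Fin m ⊕ Fin n)} {a : Fin m → M}
    {b : Fin n → M} : Sat (subst φ (σ ∘ a)) (σ ∘ b) ↔ Sat (subst φ a) b := by
  rw [sat_subst, sat_subst, ← Sum.comp_elim, StrongHomClass.realize_formula σ]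

theorem sat_equiv_of_fixed (σ : M ≃[L] M) {ψ : PFormula L M n} (h : ∀ c ∈ params ψ, σ c = c)
    {b : Fin n → M} : Sat ψ (σ ∘ b) ↔ Sat ψ b := by
  classical
  rw [Sat, Sat, ← StrongHomClass.realize_formula σ (v := Sum.elim id b)]
  refine realize_congr_freeVar ψ ?_
  rintro (c | i) hx
  · exact (h c hx).symm
  · rfl

/-- A formula whose parameters come from the range of `e` is equivalent to an instance of a
formula in the variables indexing `e`. -/
theorem exists_formula_of_params_subset {δ : Type*} (ψ : PFormula L M n) (P : δ → M)
    (h : params ψ ⊆ Set.range P) :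
    ∃ θ : L.Formula (δ ⊕ Fin n), ∀ b, Sat ψ b ↔ θ.Realize (Sum.elim P b) := by
  classical
  have h' : ∀ x : ψ.freeVarFinset, ∃ y : δ ⊕ Fin n, ∀ b : Fin n → M,
      Sum.elim P b y = Sum.elim id b x.1 := by
    rintro ⟨c | i, hx⟩
    · obtain ⟨y, hy⟩ := h hx
      exact ⟨Sum.inl y, fun _ => hy⟩
    · exact ⟨Sum.inr i, fun _ => rfl⟩
  choose e he using h'
  exact ⟨BoundedFormula.restrictFreeVar ψ e, fun b =>
    (BoundedFormula.realize_restrictFreeVar _ fun x => he x b).symm⟩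

theorem definable_sat {A : Set M} (ψ : PFormula L M n) (h : params ψ ⊆ A) :
    A.Definable L {b : Fin n → M | Sat ψ b} := by
  obtain ⟨θ, hθ⟩ := exists_formula_of_params_subset ψ (Subtype.val : A → M) (by simpa using h)
  exact Set.definable_iff_exists_formula_sum.2 ⟨θ, Set.ext hθ⟩

theorem exists_pformula_of_definable {A : Set M} {S : Set (Fin n → M)} (h : A.Definable L S) :
    ∃ ψ : PFormula L M n, params ψ ⊆ A ∧ ∀ b, Sat ψ b ↔ b ∈ S := by
  obtain ⟨θ, rfl⟩ := Set.definable_iff_exists_formula_sum.1 h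
  refine ⟨θ.relabel (Sum.map (↑) id), fun c hc => ?_, fun b => ?_⟩
  · obtain ⟨x, hx⟩ := params_relabel_subset _ _ hc
    rcases x with a | i
    · exact Sum.inl_injective hx ▸ a.2
    · exact absurd hx (by simp)
  · rw [Sat, Formula.realize_relabel, Sum.elim_comp_map]
    rfl

/-- The finite approximations to "this branch is consistent with `p`" are first-order conditions on
the unknown parameters `v` of a tree. This and the next lemma make trees accessible to compactness.
-/
theorem definable_exists_sat {V J : Type*} {A : Set M} (φ : L.Formula (Fin m ⊕ Fin n))
    (s : Finset (PFormula L M n)) (hs : ∀ ψ ∈ s, params ψ ⊆ A) (F : Finset J)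
    (e : J → Fin m → V) :
    A.Definable L {v : V → M | ∃ b, (∀ ψ ∈ s, Sat ψ b) ∧
      ∀ j ∈ F, Sat (subst φ (fun r => v (e j r))) b} := by
  have h1 : A.Definable L (⋂ ψ : s, {w : V ⊕ Fin n → M | Sat ψ.1 (w ∘ Sum.inr)}) :=
    Set.definable_iInter_of_finite fun ψ =>
      (definable_sat ψ.1 (hs ψ.1 ψ.2)).preimage_comp Sum.inr
  have h2 : A.Definable L (⋂ j : F, {w : V ⊕ Fin n → M |
      φ.Realize (w ∘ Sum.map (e j) id)}) :=
    Set.definable_iInter_of_finite fun j =>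
      ((Set.empty_definable_iff.2 ⟨φ, rfl⟩).mono (Set.empty_subset A)).preimage_comp
        (Sum.map (e j) id)
  refine (congrArg (A.Definable L) (Set.ext fun v => ?_)).mp (h1.inter h2).exists_of_finite
  simp only [Set.mem_inter_iff, Set.mem_iInter, Set.mem_ofPred_eq, Subtype.forall, sat_subst,
    Sum.elim_comp_inr, Sum.elim_comp_map]
  rfl

theorem definable_not_exists_sat {V J : Type*} (A : Set M) (φ : L.Formula (Fin m ⊕ Fin n))
    (F : Finset J) (e : J → Fin m → V) :
    A.Definable L {v : V → M | ¬ ∃ b, ∀ j ∈ F, Sat (subst φ (fun r => v (e j r))) b} := by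
  simpa [Set.compl_ofPred] using (definable_exists_sat φ ∅ (A := A) (by simp) F e).compl

end Semantics

/-! ### Saturation in many variables, homogeneity for finite tuples -/

section Monster

variable {L : FirstOrder.Language.{u, v}} {M : Type w} [L.Structure M] {n m : ℕ}
  {κ : Cardinal.{w}}

theorem IsMonster.aleph0_lt (hκ : IsMonster L M κ) : ℵ₀ < κ := by
  simpa using hκ.large ℵ₀

/-- Index sets such as `Set.Iio α` live one universe above the cardinals that `large` speaks of, but
they are small, and that is enough. -/
theorem IsMonster.mk_lt_of_small (hκ : IsMonster L M κ) (V : Type x) [Small.{max u v} V] :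
    Cardinal.lift.{w} #V < Cardinal.lift.{x} κ := by
  have h : Cardinal.lift.{max w x} #(Shrink.{max u v} V) < Cardinal.lift.{max u v x} κ := by
    simpa only [Cardinal.lift_lift] using
      Cardinal.lift_lt.{max w u v, x}.2 (hκ.large #(Shrink.{max u v} V))
  have e : Cardinal.lift.{max u v} #V = Cardinal.lift.{x} #(Shrink.{max u v} V) :=
    Cardinal.mk_congr_lift (equivShrink.{max u v} V)
  have e' := congrArg Cardinal.lift.{w} e
  rw [Cardinal.lift_lift, Cardinal.lift_lift] at e'
  rw [← Cardinal.lift_lt.{max w x, max u v}, Cardinal.lift_lift, Cardinal.lift_lift]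
  exact e'.trans_lt h

theorem IsMonster.mk_union_lt (hκ : IsMonster L M κ) {A B : Set M} (hA : #A < κ) (hB : #B < κ) :
    #(A ∪ B : Set M) < κ :=
  (mk_union_le A B).trans_lt (add_lt_of_lt hκ.aleph0_lt.le hA hB)

theorem mk_range_lt {V : Type*}
    (hV : Cardinal.lift.{w} #V < Cardinal.lift κ) (f : V → M) : #(Set.range f) < κ := by
  rw [← Cardinal.lift_lt]
  exact mk_range_le_lift.trans_lt hV

theorem definable_finite_support {V : Type*} {A : Set M} {S : Set (V → M)}
    (hS : A.Definable L S) : ∃ (W : Finset V) (S₀ : Set (W → M)), A.Definable L S₀ ∧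
      ∀ v : V → M, v ∈ S ↔ (fun x : W => v x) ∈ S₀ := by
  classical
  obtain ⟨φ, rfl⟩ := hS
  refine ⟨BoundedFormula.freeVarFinset φ,
    {x | Formula.Realize (L := L[[A]]) (BoundedFormula.restrictFreeVar φ id) x},
    ⟨BoundedFormula.restrictFreeVar φ id, rfl⟩, fun v => ?_⟩
  exact (BoundedFormula.realize_restrictFreeVar (L := L[[A]]) (φ := φ) (f := id)
    (v := fun x : BoundedFormula.freeVarFinset φ => v x) v fun _ => rfl).symm

/-- Membership in `S` depends on finitely many coordinates, so only those need quantifying; the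
others can be filled in arbitrarily. -/
theorem definable_proj [Nonempty M] {V : Type*} {A : Set M} {S : Set (V → M)}
    (hS : A.Definable L S) (e : Fin n → V) :
    A.Definable L {b : Fin n → M | ∃ v ∈ S, ∀ i, v (e i) = b i} := by
  classical
  obtain ⟨W, S₀, h₀, hW⟩ := definable_finite_support hS
  let W' : Finset V := W ∪ Finset.univ.image e
  let i : W → W' := fun x => ⟨x, Finset.mem_union_left _ x.2⟩
  let e' : Fin n → W' := fun j => ⟨e j, Finset.mem_union_right _ (by simp)⟩
  refine (congrArg (A.Definable L) (Set.ext fun b => ?_)).mp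
    ((h₀.preimage_comp i).image_comp e')
  constructor
  · rintro ⟨v, hv, rfl⟩
    refine ⟨fun x => if h : x ∈ W' then v ⟨x, h⟩ else Classical.arbitrary M, ?_, fun j => ?_⟩
    · rw [hW]
      have : (fun x : W => if h : x.1 ∈ W' then v ⟨x, h⟩ else Classical.arbitrary M) = v ∘ i :=
        funext fun x => dif_pos (i x).2
      exact this ▸ hv
    · exact dif_pos _
  · rintro ⟨v, hv, hb⟩
    exact ⟨fun x => v x, (hW v).1 hv, funext hb⟩

/-- Saturation for fewer than `κ` variables. -/
theorem IsMonster.exists_of_fip [Nonempty M] (hκ : IsMonster L M κ) {V : Type*}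
    (hV : Cardinal.lift.{w} #V < Cardinal.lift κ) {A : Set M} (hA : #A < κ) {J : Type*}
    (S : J → Set (V → M)) (hS : ∀ j, A.Definable L (S j))
    (hfip : ∀ t : Finset J, ∃ v, ∀ j ∈ t, v ∈ S j) : ∃ v, ∀ j, v ∈ S j := by
  classical
  -- Graphs of partial assignments that are finitely consistent with the conditions. Tukey's lemma
  -- gives a maximal one; saturation in one variable shows that it is total.
  let F : Set (Set (V × M)) := {G | ∀ t : Finset J, ∀ g ⊆ G, g.Finite →
    ∃ v, (∀ j ∈ t, v ∈ S j) ∧ ∀ e ∈ g, v e.1 = e.2}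
  have hF : Order.IsOfFiniteCharacter F := fun x =>
    ⟨fun hx y hy _ t g hg => hx t g (hg.trans hy), fun h t g hg hfin =>
      h g hg hfin t g subset_rfl hfin⟩
  obtain ⟨G, -, hG⟩ := hF.exists_maximal (x := ∅) fun t g hg _ => by
    obtain ⟨v, hv⟩ := hfip t
    exact ⟨v, hv, fun e he => (hg he).elim⟩
  have hGF : G ∈ F := hG.prop
  have hfun : ∀ x y y', (x, y) ∈ G → (x, y') ∈ G → y = y' := by
    intro x y y' h h'
    obtain ⟨v, -, hv⟩ := hGF ∅ {(x, y), (x, y')} (by simp [Set.insert_subset_iff, h, h'])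
      (Set.toFinite _)
    exact (hv (x, y) (by simp)).symm.trans (hv (x, y') (by simp))
  have htot : ∀ x, ∃ y, (x, y) ∈ G := by
    intro x
    -- The values assigned so far: there are at most `#V` of them, because `G` is single-valued.
    let R : Set M := {y | ∃ z, (z, y) ∈ G}
    have hR : #R < κ := by
      choose f hf using fun y : R => y.2
      rw [← Cardinal.lift_lt]
      refine (lift_mk_le_lift_mk_of_injective (f := f) fun y y' h => ?_).trans_lt hV
      exact Subtype.ext (hfun _ _ _ (hf y) (h ▸ hf y'))
    let E : Finset J → Set (V × M) → Set (V → M) := fun t g =>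
      {v | (∀ j ∈ t, v ∈ S j) ∧ ∀ e ∈ g, v e.1 = e.2}
    have hE : ∀ t, ∀ g ⊆ G, g.Finite → (A ∪ R).Definable L (E t g) := by
      intro t g hg hfin
      have := hfin.to_subtype
      have h1 : (A ∪ R).Definable L (⋂ j : t, S j) :=
        Set.definable_iInter_of_finite fun j => (hS j).mono Set.subset_union_left
      have h2 : (A ∪ R).Definable L (⋂ e : g, {v : V → M | v e.1.1 = e.1.2}) := by
        refine Set.definable_iInter_of_finite fun e => Set.definable_iff_exists_formula_sum.2
          ⟨(Term.var (Sum.inr e.1.1)).equal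
            (Term.var (Sum.inl ⟨e.1.2, Or.inr ⟨e.1.1, hg e.2⟩⟩)), ?_⟩
        ext v
        simp [Formula.realize_equal]
      refine (congrArg ((A ∪ R).Definable L) (Set.ext fun v => ?_)).mp (h1.inter h2)
      simp [E]
    -- What finitely many constraints imply about the value at `x`.
    let P : Set (PFormula L M 1) := {θ | params θ ⊆ A ∪ R ∧ ∃ t : Finset J, ∃ g ⊆ G, g.Finite ∧
      ∀ v ∈ E t g, Sat θ fun _ => v x}
    have hP : IsPartialType (A ∪ R) P := by
      refine ⟨fun c ⟨θ, hθ, hc⟩ => hθ.1 hc, fun s hs => ?_⟩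
      choose! t g hg hfin htg using fun θ (h : θ ∈ s) => (hs h).2
      obtain ⟨v, hv⟩ := hGF (s.biUnion t) (⋃ θ ∈ s, g θ) (by simpa using hg)
        (s.finite_toSet.biUnion hfin)
      refine ⟨fun _ => v x, fun θ hθ => htg θ hθ v ⟨fun j hj => hv.1 j ?_, fun e he => hv.2 e ?_⟩⟩
      · exact Finset.mem_biUnion.2 ⟨θ, hθ, hj⟩
      · exact Set.mem_biUnion (s := (s : Set _)) hθ he
    obtain ⟨b, hb⟩ := hκ.saturated (A ∪ R) (hκ.mk_union_lt hA hR) P hP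
    refine ⟨b 0, ?_⟩
    suffices h : insert (x, b 0) G ∈ F from
      hG.le_of_ge h (Set.subset_insert _ _) (Set.mem_insert _ _)
    intro t g hg hfin
    have hg' : g \ {(x, b 0)} ⊆ G := by
      rw [Set.sdiff_subset_iff, Set.singleton_union]
      exact hg
    have hd := hE t _ hg' hfin.sdiff
    -- The projection of the constraints in `t` and `g` to the coordinate `x` is defined by a
    -- formula of `P`, so the realization `b` lifts to a full assignment meeting them.
    obtain ⟨ψ, hψ, hψs⟩ := exists_pformula_of_definable (definable_proj hd fun _ : Fin 1 => x)
    have hmem : ψ ∈ P := ⟨hψ, t, _, hg', hfin.sdiff, fun v hv => (hψs _).2 ⟨v, hv, fun _ => rfl⟩⟩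
    obtain ⟨v, hv, hvx⟩ := (hψs b).1 (hb ψ hmem)
    refine ⟨v, hv.1, fun e he => ?_⟩
    by_cases h : e = (x, b 0)
    · subst h
      exact hvx 0
    · exact hv.2 e ⟨he, h⟩
  choose f hf using htot
  refine ⟨f, fun j => ?_⟩
  obtain ⟨W, S₀, -, hW⟩ := definable_finite_support (hS j)
  obtain ⟨v, hv, hvg⟩ := hGF {j} ((fun x => (x, f x)) '' (W : Set V))
    (by rintro _ ⟨x, -, rfl⟩; exact hf x) (W.finite_toSet.image _)
  have hvj := hv j (by simp)
  rw [hW] at hvj ⊢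
  convert hvj using 1
  funext x
  exact (hvg _ ⟨x, x.2, rfl⟩).symm

/-- Saturation for types in finitely many variables. -/
theorem IsMonster.exists_realization [Nonempty M] (hκ : IsMonster L M κ) {A : Set M} (hA : #A < κ)
    {q : Set (PFormula L M n)} (hq : IsPartialType A q) : ∃ b, ∀ φ ∈ q, Sat φ b := by
  classical
  obtain ⟨b, hb⟩ := hκ.exists_of_fip (hκ.mk_lt_of_small (Fin n)) hA
    (fun φ : q => {b : Fin n → M | Sat φ.1 b})
    (fun φ => definable_sat φ.1 ((params_subset_dom φ.2).trans hq.1)) fun t => by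
      obtain ⟨b, hb⟩ := hq.2 (t.image Subtype.val) (by simp)
      exact ⟨b, fun φ hφ => hb φ (Finset.mem_image_of_mem _ hφ)⟩
  exact ⟨b, fun φ hφ => hb ⟨φ, hφ⟩⟩

/-- Homogeneity for finite tuples: tuples with the same type are conjugate. -/
theorem IsMonster.exists_equiv (hκ : IsMonster L M κ) {B : Set M} (hB : #B < κ)
    {a c : Fin m → M} (h : SameType (L := L) B a c) :
    ∃ σ : M ≃[L] M, (∀ x ∈ B, σ x = x) ∧ σ ∘ a = c := by
  classical
  let B' : Set M := B ∪ Set.range a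
  have hB' : #B' < κ := hκ.mk_union_lt hB
    ((mk_le_aleph0 (α := Set.range a)).trans_lt hκ.aleph0_lt)
  -- Each element is named by itself if it lies in `B`, and by a coordinate of `a` otherwise.
  -- Preferring the first name makes the automorphism fix `B` pointwise.
  have hvar : ∀ x : B', ∃ y : M ⊕ Fin m, (∀ z, y = Sum.inl z → z ∈ B) ∧
      Sum.elim id a y = x ∧ (x.1 ∈ B → y = Sum.inl x.1) := by
    rintro ⟨x, hx⟩
    by_cases hxB : x ∈ B
    · exact ⟨Sum.inl x, by rintro z ⟨⟩; exact hxB, rfl, fun _ => rfl⟩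
    · obtain ⟨j, rfl⟩ := hx.resolve_left hxB
      exact ⟨Sum.inr j, by rintro z ⟨⟩, rfl, fun h => (hxB h).elim⟩
  choose y hy hya hyB using hvar
  obtain ⟨σ, hσ⟩ := hκ.homogeneous B' hB' (fun x => Sum.elim id c (y x)) fun φ => by
    have := h (φ.relabel y) (by
      intro z hz
      obtain ⟨x, hx⟩ := params_relabel_subset _ _ hz
      exact hy x z hx)
    rw [Sat, Sat, Formula.realize_relabel, Formula.realize_relabel] at this
    have e : Sum.elim id a ∘ y = Subtype.val := funext hya
    rwa [e] at this
  refine ⟨σ, fun x hx => ?_, funext fun j => ?_⟩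
  · rw [hσ ⟨x, Or.inl hx⟩, hyB _ hx]
    rfl
  · have hj : a j ∈ B' := Or.inr ⟨j, rfl⟩
    rw [Function.comp_apply, hσ ⟨a j, hj⟩]
    -- The name chosen for `a j` need not be the variable `j`; the equation between the two belongs
    -- to the type of `a`, hence holds of `c`.
    have := h ((Term.var (y ⟨a j, hj⟩)).equal (Term.var (Sum.inr j))) (by
      intro z hz
      have hz' : Sum.inl z ∈ BoundedFormula.freeVarFinset
        ((Term.var (y ⟨a j, hj⟩)).equal (Term.var (Sum.inr j)) : PFormula L M m) := hz
      refine hy ⟨a j, hj⟩ z ?_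
      simpa [Term.equal, Term.bdEqual, BoundedFormula.freeVarFinset, Term.varFinsetLeft,
        eq_comm] using hz')
    simpa [Sat, Formula.realize_equal, hya] using this

end Monster

/-- A formula `φ(y, x)` with a number `k`, for `k`-inconsistent families of instances `φ(c, x)`. -/
abbrev Pattern (L : FirstOrder.Language.{u, v}) (n : ℕ) :=
  Σ m : ℕ, L.Formula (Fin m ⊕ Fin n) × ℕ

theorem exists_injective_const {X : Type*} [Finite X] (g : ℕ → X) :
    ∃ (x : X) (e : ℕ → ℕ), Function.Injective e ∧ ∀ i, g (e i) = x := by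
  obtain ⟨x, hx⟩ := Finite.exists_infinite_fiber g
  have := hx
  let e := Infinite.natEmbedding (g ⁻¹' {x})
  exact ⟨x, fun i => e i, Subtype.val_injective.comp e.injective, fun i => (e i).2⟩

/-! ### The local rank: forking raises it, and one pattern suffices -/

section Rank

variable {L : FirstOrder.Language.{u, v}} {M : Type w} [L.Structure M] {n m : ℕ}
  {κ : Cardinal.{w}}

theorem KInconsistent.comp_injective {k : ℕ} {ψ : ℕ → PFormula L M n} (h : KInconsistent k ψ)
    {e : ℕ → ℕ} (he : Function.Injective e) : KInconsistent k fun i => ψ (e i) := by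
  rintro s hs ⟨b, hb⟩
  exact h (s.map ⟨e, he⟩) (by simpa using hs) ⟨b, by simpa using hb⟩

theorem KInconsistent.map_equiv {k : ℕ} {φ : L.Formula (Fin m ⊕ Fin n)} {c : ℕ → Fin m → M}
    (h : KInconsistent k fun i => subst φ (c i)) (σ : M ≃[L] M) :
    KInconsistent k fun i => subst φ (σ ∘ c i) := by
  rintro s hs ⟨b, hb⟩
  refine h s hs ⟨σ.symm ∘ b, fun i hi => ?_⟩
  rw [← sat_subst_equiv σ]
  convert hb i hi
  funext j
  simp

theorem Consistent.map {q q' : Set (PFormula L M n)} (σ : M → M)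
    (h : ∀ χ ∈ q', ∃ χ₀ ∈ q, ∀ b, Sat χ₀ b → Sat χ (σ ∘ b)) (hq : Consistent q) :
    Consistent q' := by
  classical
  intro s hs
  choose! g hg hgs using h
  obtain ⟨b, hb⟩ := hq (s.image g) (by
    intro χ hχ
    obtain ⟨χ', hχ', rfl⟩ := Finset.mem_image.1 (Finset.mem_coe.1 hχ)
    exact hg χ' (hs hχ'))
  exact ⟨σ ∘ b, fun χ hχ => hgs χ (hs hχ) b (hb _ (Finset.mem_image_of_mem g hχ))⟩

theorem Consistent.mono {q q' : Set (PFormula L M n)} (h : q' ⊆ q) (hq : Consistent q) :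
    Consistent q' :=
  fun s hs => hq s (hs.trans h)

/-- `TreeRank Δ N q`: there is an infinitely branching tree of depth `N` of instances of patterns
in `Δ`, with inconsistent siblings and with branches that are consistent with `q`. -/
def TreeRank (Δ : Set (Pattern L n)) : ℕ → Set (PFormula L M n) → Prop
  | 0, q => Consistent q
  | N + 1, q => ∃ δ ∈ Δ, ∃ c : ℕ → Fin δ.1 → M, KInconsistent δ.2.2 (fun i => subst δ.2.1 (c i)) ∧
      ∀ i, TreeRank Δ N (q ∪ {subst δ.2.1 (c i)})

theorem TreeRank.map {Δ : Set (Pattern L n)} (σ : M ≃[L] M) {N : ℕ} {q q' : Set (PFormula L M n)}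
    (h : ∀ χ ∈ q', ∃ χ₀ ∈ q, ∀ b, Sat χ₀ b → Sat χ (σ ∘ b)) (hq : TreeRank Δ N q) :
    TreeRank Δ N q' := by
  induction N generalizing q q' with
  | zero => exact Consistent.map σ h hq
  | succ N ih =>
    obtain ⟨δ, hδ, c, hc, hcN⟩ := hq
    refine ⟨δ, hδ, fun i => σ ∘ c i, hc.map_equiv σ, fun i => ih ?_ (hcN i)⟩
    rintro χ (hχ | rfl)
    · obtain ⟨χ₀, h₀, hs⟩ := h χ hχ
      exact ⟨χ₀, Or.inl h₀, hs⟩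
    · exact ⟨_, Or.inr rfl, fun b => (sat_subst_equiv σ).2⟩

theorem TreeRank.mono {Δ : Set (Pattern L n)} {N : ℕ} {q q' : Set (PFormula L M n)}
    (h : q' ⊆ q) (hq : TreeRank Δ N q) : TreeRank Δ N q' :=
  hq.map (Language.Equiv.refl L M) fun χ hχ => ⟨χ, h hχ, fun _ hb => hb⟩

theorem TreeRank.consistent {Δ : Set (Pattern L n)} {N : ℕ} {q : Set (PFormula L M n)}
    (hq : TreeRank Δ N q) : Consistent q := by
  induction N generalizing q with
  | zero => exact hq
  | succ N ih =>
    obtain ⟨δ, hδ, c, hc, hcN⟩ := hq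
    exact (ih (hcN 0)).mono Set.subset_union_left

theorem Consistent.exists_of_implies {q : Set (PFormula L M n)} (hq : Consistent q)
    {D : Finset (PFormula L M n)} (hD : Implies q D) : ∃ ψ ∈ D, Consistent (q ∪ {ψ}) := by
  classical
  obtain ⟨s, hs, hsD⟩ := hD
  by_contra! hcon
  simp only [Consistent, not_forall, not_exists] at hcon
  choose! t htq ht using hcon
  -- If every disjunct were inconsistent with `q`, a realization of `s` and of all the finite
  -- refuting sets would satisfy no disjunct.
  obtain ⟨b, hb⟩ := hq (s ∪ D.biUnion fun ψ => (t ψ).erase ψ) (by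
    intro χ hχ
    simp only [Finset.coe_union, Set.mem_union, Finset.mem_coe, Finset.mem_biUnion,
      Finset.mem_erase] at hχ
    rcases hχ with h | ⟨ψ, hψ, hne, h⟩
    · exact hs h
    · exact (htq ψ hψ h).resolve_right hne)
  obtain ⟨ψ, hψD, hψ⟩ := hsD b fun φ hφ => hb φ (Finset.mem_union_left _ hφ)
  obtain ⟨χ, hχ, hχb⟩ := ht ψ hψD b
  refine hχb ?_
  by_cases h : χ = ψ
  · exact h ▸ hψ
  · exact hb χ (Finset.mem_union_right _ (Finset.mem_biUnion.2
      ⟨ψ, hψD, Finset.mem_erase.2 ⟨h, hχ⟩⟩))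

theorem Implies.mono {q q' : Set (PFormula L M n)} {D : Finset (PFormula L M n)}
    (hD : Implies q D) (h : q ⊆ q') : Implies q' D :=
  let ⟨s, hs, hsD⟩ := hD
  ⟨s, hs.trans h, hsD⟩

theorem Forks.mono {A : Set M} {q q' : Set (PFormula L M n)} (hq : Forks A q) (h : q ⊆ q') :
    Forks A q' :=
  let ⟨D, hD, hqD⟩ := hq
  ⟨D, hD, hqD.mono h⟩

/-- By induction each child of the root keeps its rank after adding some disjunct. There are
finitely many disjuncts, so infinitely many children share one, and the tree is restricted to these.
-/
theorem TreeRank.exists_of_implies {Δ : Set (Pattern L n)} {N : ℕ} {q : Set (PFormula L M n)}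
    (hq : TreeRank Δ N q) {D : Finset (PFormula L M n)} (hD : Implies q D) :
    ∃ ψ ∈ D, TreeRank Δ N (q ∪ {ψ}) := by
  induction N generalizing q with
  | zero => exact Consistent.exists_of_implies hq hD
  | succ N ih =>
    obtain ⟨δ, hδ, c, hc, hcN⟩ := hq
    choose ψ hψD hψ using fun i => ih (hcN i) (hD.mono Set.subset_union_left)
    obtain ⟨⟨χ, hχ⟩, e, he, heq⟩ := exists_injective_const fun i => (⟨ψ i, hψD i⟩ : D)
    refine ⟨χ, hχ, δ, hδ, fun i => c (e i), hc.comp_injective he, fun i => ?_⟩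
    have : ψ (e i) = χ := congrArg Subtype.val (heq i)
    rw [Set.union_right_comm, ← this]
    exact hψ (e i)

/-- Forking raises the rank, for a suitable finite set of patterns. -/
theorem IsMonster.exists_treeRank_succ (hκ : IsMonster L M κ) {B : Set M} (hB : #B < κ)
    {q q' : Set (PFormula L M n)} (hq : dom q ⊆ B) (hqq' : q ⊆ q') (hf : Forks B q') :
    ∃ Δ : Finset (Pattern L n), ∀ N, TreeRank (Δ : Set (Pattern L n)) N q' →
      TreeRank (Δ : Set (Pattern L n)) (N + 1) q := by
  classical
  obtain ⟨D, hD, hqD⟩ := hf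
  choose! m φ a hψ k c hc hk using hD
  refine ⟨D.image fun ψ => ⟨m ψ, φ ψ, k ψ⟩, fun N hN => ?_⟩
  obtain ⟨ψ, hψD, hψN⟩ := hN.exists_of_implies hqD
  refine ⟨⟨m ψ, φ ψ, k ψ⟩, Finset.mem_coe.2 (Finset.mem_image_of_mem _ hψD), c ψ hψD, hk ψ hψD,
    fun i => ?_⟩
  -- An automorphism over `B` fixes the parameters of `q` and moves the dividing instance to its
  -- `i`-th conjugate, so every conjugate retains rank `N` with `q`.
  obtain ⟨σ, hσB, hσ⟩ := hκ.exists_equiv hB (hc ψ hψD i)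
  refine hψN.map σ ?_
  rintro χ (hχ | rfl)
  · exact ⟨χ, Or.inl (hqq' hχ), fun b => (sat_equiv_of_fixed σ fun x hx =>
      hσB x (hq (params_subset_dom hχ hx))).2⟩
  · refine ⟨ψ, Or.inr rfl, fun b hb => ?_⟩
    rw [← hσ, sat_subst_equiv, ← hψ ψ hψD]
    exact hb

/-- Let `δ` be the pattern at the root. If some child already attains the target `r ε` for another
pattern `ε`, then so does `q`. Otherwise induction, with the target of `δ` lowered by one, gives
every child rank `r δ - 1` for `δ` alone, and the root adds the missing level. -/
theorem TreeRank.exists_single [DecidableEq (Pattern L n)] {Δ : Finset (Pattern L n)} {N : ℕ}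
    {q : Set (PFormula L M n)} (hq : TreeRank (Δ : Set (Pattern L n)) (N + 1) q)
    {r : Pattern L n → ℕ} (hr : ∑ δ ∈ Δ, r δ ≤ N) : ∃ δ ∈ Δ, TreeRank {δ} (r δ) q := by
  induction N generalizing q r with
  | zero =>
    have hc := hq.consistent
    obtain ⟨δ, hδ, -⟩ := hq
    refine ⟨δ, hδ, ?_⟩
    rw [Finset.sum_eq_zero_iff.1 (Nat.le_zero.1 hr) δ hδ]
    exact hc
  | succ N ih =>
    have hcon := hq.consistent
    obtain ⟨δ, hδ, c, hc, hcN⟩ := hq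
    rcases hrδ : r δ with _ | l
    · exact ⟨δ, hδ, hrδ ▸ hcon⟩
    have hsum : ∑ ε ∈ Δ, Function.update r δ l ε ≤ N := by
      have h1 := Finset.sum_update_of_mem hδ r l
      have h2 := Finset.sum_eq_add_sum_sdiff_singleton_of_mem hδ r
      omega
    by_cases h : ∃ i, ∃ ε ∈ Δ, ε ≠ δ ∧ TreeRank {ε} (r ε) (q ∪ {subst δ.2.1 (c i)})
    · obtain ⟨i, ε, hε, -, hεr⟩ := h
      exact ⟨ε, hε, hεr.mono Set.subset_union_left⟩
    · push Not at h
      refine ⟨δ, hδ, hrδ ▸ ⟨δ, rfl, c, hc, fun i => ?_⟩⟩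
      obtain ⟨ε, hε, hεr⟩ := ih (hcN i) hsum
      by_cases hεδ : ε = δ
      · subst hεδ
        simpa using hεr
      · rw [Function.update_of_ne hεδ] at hεr
        exact (h i ε hε hεδ hεr).elim

theorem exists_single_unbounded {Δ : Finset (Pattern L n)} {q : Set (PFormula L M n)}
    (hq : ∀ N, TreeRank (Δ : Set (Pattern L n)) N q) : ∃ δ, ∀ N, TreeRank {δ} N q := by
  classical
  by_contra! h
  choose r hr using h
  obtain ⟨δ, -, hδ⟩ := (hq (∑ δ ∈ Δ, r δ + 1)).exists_single le_rfl
  exact hr δ hδ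

end Rank

/-! ### Reducing finitely many levels to finite sequences -/

/-- Lists `F` increasingly, with `r β` the position of `β`: finitely many ordinal levels then become
the first levels of a tree on `ω^{<ω}`. -/
theorem exists_enumeration {I : Type*} [LinearOrder I] [Nonempty I] (F : Finset I) :
    ∃ (e : ℕ → I) (r : I → ℕ), ∀ β ∈ F, e (r β) = β ∧ ∀ j < r β, e j < β := by
  classical
  have h : ∀ β ∈ F, ∃ x : Fin F.card, F.orderEmbOfFin rfl x = β := fun β hβ =>
    (Finset.range_orderEmbOfFin F rfl).symm.subset hβ
  choose r hr using h
  refine ⟨fun j => if h : j < F.card then F.orderEmbOfFin rfl ⟨j, h⟩ else Classical.arbitrary I,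
    fun β => if h : β ∈ F then r β h else 0, fun β hβ => ⟨?_, fun j hj => ?_⟩⟩
  · simp [hβ, hr]
  · simp only [dif_pos hβ] at hj
    simp only [dif_pos (hj.trans (r β hβ).2)]
    conv_rhs => rw [← hr β hβ]
    exact (F.orderEmbOfFin rfl).strictMono hj

/-- Thinning out a tree along finitely many levels: a path with siblings that cannot be told apart
from the path by a given finite colouring over the lower part of the path. -/
theorem exists_homogeneous_path {I E X : Type*} [LinearOrder I] [Finite X] (a : List ℕ → E)
    (G : I → (I → E) → E → X) (hG : ∀ i b b', (∀ j < i, b j = b' j) → G i b = G i b')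
    (F : Finset I) : ∃ (t : List ℕ) (c : I → ℕ → E), ∀ i ∈ F, ∃ (s : List ℕ) (e : ℕ → ℕ),
      Function.Injective e ∧ (∀ l, c i l = a (s ++ [e l])) ∧ s ++ [e 0] <+: t ∧
      ∀ l, G i (fun j => c j 0) (c i l) = G i (fun j => c j 0) (c i 0) := by
  classical
  induction F using Finset.induction_on_max with
  | empty => exact ⟨[], fun _ _ => a [], by simp⟩
  | insert i F hi ih =>
    obtain ⟨t, c, hc⟩ := ih
    -- The new level `i` is the highest, so the path below is already fixed; infinitely many
    -- children of its end `t` have the same colour.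
    obtain ⟨x, e, he, hx⟩ := exists_injective_const fun l => G i (fun j => c j 0) (a (t ++ [l]))
    refine ⟨t ++ [e 0], Function.update c i fun l => a (t ++ [e l]), fun i' hi' => ?_⟩
    -- Colours at levels up to `i` see only the path strictly below, so choosing level `i` does not
    -- disturb them.
    have hGc : ∀ i' ≤ i, G i' (fun j => Function.update c i (fun l => a (t ++ [e l])) j 0) =
        G i' fun j => c j 0 := fun i' hi' => hG _ _ _ fun j hj => by
      rw [Function.update_of_ne (hj.trans_le hi').ne]
    rcases Finset.mem_insert.1 hi' with rfl | hF
    · refine ⟨t, e, he, fun l => by simp, List.prefix_rfl, fun l => ?_⟩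
      rw [hGc _ le_rfl]
      simp [hx]
    · obtain ⟨s, e', he', hs, hst, hsG⟩ := hc i' hF
      refine ⟨s, e', he', fun l => ?_, hst.trans (List.prefix_append _ _), fun l => ?_⟩
      · rw [Function.update_of_ne (hi i' hF).ne, hs]
      · rw [hGc _ (hi i' hF).le, Function.update_of_ne (hi i' hF).ne, hsG]

section Branch

variable {L : FirstOrder.Language.{u, v}} {M : Type w} {n m : ℕ}

/-- The instances of `φ` at the nonempty initial segments of `t`. -/
def branch (φ : L.Formula (Fin m ⊕ Fin n)) (a : List ℕ → Fin m → M) (t : List ℕ) :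
    Set (PFormula L M n) :=
  {ψ | ∃ j, j < t.length ∧ ψ = subst φ (a (t.take (j + 1)))}

theorem branch_mono {φ : L.Formula (Fin m ⊕ Fin n)} {a : List ℕ → Fin m → M} {s t : List ℕ}
    (h : s <+: t) : branch φ a s ⊆ branch φ a t := by
  rintro ψ ⟨j, hj, rfl⟩
  refine ⟨j, hj.trans_le h.length_le, ?_⟩
  obtain ⟨u, rfl⟩ := h
  rw [List.take_append_of_le_length hj]

end Branch

/-! ### Pattern trees from unbounded rank, and trees of any ordinal depth -/

section Constructions

variable {L : FirstOrder.Language.{u, v}} {M : Type w} [L.Structure M] {n m : ℕ}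
  {κ : Cardinal.{w}}

/-- Separates a finite part of the union into formulas of `p` and a finite set of indices, the shape
required by `definable_exists_sat`. -/
theorem consistent_union_iff {J : Type*} {p : Set (PFormula L M n)} {P : J → Prop}
    {φ : L.Formula (Fin m ⊕ Fin n)} {e : J → Fin m → M} :
    Consistent (p ∪ {ψ | ∃ j, P j ∧ ψ = subst φ (e j)}) ↔
      ∀ s : Finset (PFormula L M n), (s : Set (PFormula L M n)) ⊆ p → ∀ F : Finset J,
        (∀ j ∈ F, P j) → ∃ b, (∀ ψ ∈ s, Sat ψ b) ∧ ∀ j ∈ F, Sat (subst φ (e j)) b := by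
  classical
  constructor
  · intro h s hs F hF
    obtain ⟨b, hb⟩ := h (s ∪ F.image fun j => subst φ (e j)) (by
      intro χ hχ
      simp only [Finset.coe_union, Set.mem_union, Finset.mem_coe, Finset.mem_image] at hχ
      rcases hχ with h | ⟨j, hj, rfl⟩
      · exact Or.inl (hs h)
      · exact Or.inr ⟨j, hF j hj, rfl⟩)
    exact ⟨b, fun ψ hψ => hb ψ (Finset.mem_union_left _ hψ), fun j hj =>
      hb _ (Finset.mem_union_right _ (Finset.mem_image_of_mem _ hj))⟩
  · intro h s hs
    have hJ : ∀ χ ∈ s, χ ∉ p → ∃ j, P j ∧ χ = subst φ (e j) := fun χ hχ hp =>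
      (hs hχ).resolve_left hp
    choose j hj hχj using hJ
    obtain ⟨b, hb, hbF⟩ := h (s.filter (· ∈ p)) (fun χ hχ => (Finset.mem_filter.1 hχ).2)
      (Finset.univ.image fun χ : s.filter (· ∉ p) =>
        j χ.1 (Finset.mem_filter.1 χ.2).1 (Finset.mem_filter.1 χ.2).2) (by
        intro i hi
        obtain ⟨χ, -, rfl⟩ := Finset.mem_image.1 hi
        exact hj _ _ _)
    refine ⟨b, fun χ hχ => ?_⟩
    by_cases hp : χ ∈ p
    · exact hb χ (Finset.mem_filter.2 ⟨hχ, hp⟩)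
    · rw [hχj χ hχ hp]
      exact hbF _ (Finset.mem_image.2 ⟨⟨χ, Finset.mem_filter.2 ⟨hχ, hp⟩⟩, Finset.mem_univ _, rfl⟩)

/-- A tree of instances of the pattern `δ`, indexed by finite sequences, whose branches are
consistent with `p`. -/
def IsPatternTree (p : Set (PFormula L M n)) (δ : Pattern L n) (a : List ℕ → Fin δ.1 → M) : Prop :=
  (∀ s : List ℕ, KInconsistent δ.2.2 fun i => subst δ.2.1 (a (s ++ [i]))) ∧
    ∀ t, Consistent (p ∪ branch δ.2.1 a t)

theorem IsPatternTree.consistent_path {p : Set (PFormula L M n)} {δ : Pattern L n}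
    {a : List ℕ → Fin δ.1 → M} (ha : IsPatternTree p δ a) (f : ℕ → ℕ) :
    Consistent (p ∪ {ψ | ∃ j : ℕ, ψ = subst δ.2.1 (a ((List.range (j + 1)).map f))}) := by
  classical
  intro s hs
  have hN : ∀ χ ∈ s, ∃ N, χ ∈ p ∪ branch δ.2.1 a ((List.range N).map f) := by
    intro χ hχ
    rcases hs hχ with h | ⟨j, rfl⟩
    · exact ⟨0, Or.inl h⟩
    · refine ⟨j + 1, Or.inr ⟨j, by simp, ?_⟩⟩
      rw [List.take_of_length_le (by simp)]
  choose! N hN using hN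
  refine ha.2 ((List.range (s.sup N)).map f) s fun χ hχ =>
    Set.union_subset_union_right p (branch_mono ?_) (hN χ hχ)
  refine List.IsPrefix.map f ?_
  have : List.range (N χ) = (List.range (s.sup N)).take (N χ) := by
    rw [List.take_range, min_eq_left (Finset.le_sup hχ)]
  rw [this]
  exact List.take_prefix _ _

theorem not_isSimpleType_iff {p : Set (PFormula L M n)} :
    ¬ IsSimpleType p ↔ ∃ (δ : Pattern L n) (a : List ℕ → Fin δ.1 → M), IsPatternTree p δ a := by
  rw [IsSimpleType, not_not]
  constructor
  · rintro ⟨m, φ, k, a, hk, hp⟩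
    -- A finite sequence is continued by zeros to an infinite branch.
    refine ⟨⟨m, φ, k⟩, a, hk, fun t => (hp fun j => t.getD j 0).mono ?_⟩
    refine Set.union_subset_union_right p ?_
    rintro ψ ⟨j, hj, rfl⟩
    refine ⟨j, ?_⟩
    congr 2
    refine List.ext_getElem ?_ fun i h1 h2 => ?_
    · simp; omega
    · simp at h1
      simp [h1.2]
  · rintro ⟨δ, a, ha⟩
    exact ⟨δ.1, δ.2.1, δ.2.2, a, ha.1, ha.consistent_path⟩

theorem TreeRank.exists_finite_tree [Nonempty M] {δ : Pattern L n} {N : ℕ}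
    {q : Set (PFormula L M n)} (hq : TreeRank {δ} N q) : ∃ a : List ℕ → Fin δ.1 → M,
      (∀ s : List ℕ, s.length < N → KInconsistent δ.2.2 fun i => subst δ.2.1 (a (s ++ [i]))) ∧
      ∀ t : List ℕ, t.length ≤ N → Consistent (q ∪ branch δ.2.1 a t) := by
  induction N generalizing q with
  | zero =>
    refine ⟨fun _ _ => Classical.arbitrary M, by simp, fun t ht => ?_⟩
    obtain rfl : t = [] := by simpa using ht
    simpa [branch, TreeRank] using hq
  | succ N ih =>
    have hcon := hq.consistent
    obtain ⟨ε, hε, c, hc, hcN⟩ := hq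
    obtain rfl : δ = ε := hε.symm
    choose a ha hab using fun i => ih (hcN i)
    -- The trees above the children are glued to a new root. The value at `[]` is irrelevant, since
    -- branches use nonempty segments only; so is `a i []`, which `c i` replaces.
    let a' : List ℕ → Fin δ.1 → M := fun t => match t with
      | [] => c 0
      | i :: s => if s = [] then c i else a i s
    refine ⟨a', fun s hs => ?_, fun t ht => ?_⟩
    · rcases s with _ | ⟨i, s⟩
      · exact hc
      · have := ha i s (by simpa using hs)
        simpa [a'] using this
    · rcases t with _ | ⟨i, t⟩
      · simpa [branch] using hcon
      · refine (hab i t (by simpa using ht)).mono ?_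
        rw [Set.union_assoc]
        refine Set.union_subset_union_right q ?_
        rintro ψ ⟨j, hj, rfl⟩
        rcases j with _ | j
        · left
          simp [a']
        · right
          have hj' : j < t.length := by simpa using hj
          refine ⟨j, hj', ?_⟩
          have : t.take (j + 1) ≠ [] := by
            rw [← List.length_pos_iff]
            simp; omega
          simp only [List.take_succ_cons, a', if_neg this]

/-- Compactness in the unknown parameters of the tree: finitely many conditions reach only a bounded
depth, where a finite tree given by the rank satisfies them. -/
theorem IsMonster.exists_patternTree [Nonempty M] (hκ : IsMonster L M κ) {A : Set M} (hA : #A < κ)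
    {p : Set (PFormula L M n)} (hp : dom p ⊆ A) {δ : Pattern L n}
    (hN : ∀ N, TreeRank {δ} N p) : ∃ a : List ℕ → Fin δ.1 → M, IsPatternTree p δ a := by
  classical
  obtain ⟨m, φ, k⟩ := δ
  let J := (List ℕ × {t : Finset ℕ // t.card = k}) ⊕
    (List ℕ × {s : Finset (PFormula L M n) // (s : Set (PFormula L M n)) ⊆ p})
  let S : J → Set (List ℕ × Fin m → M) := fun j => match j with
    | Sum.inl (s, t) => {v | ¬ ∃ b, ∀ i ∈ t.1, Sat (subst φ fun r => v (s ++ [i], r)) b}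
    | Sum.inr (t, s) => {v | ∃ b, (∀ ψ ∈ s.1, Sat ψ b) ∧
        ∀ j ∈ Finset.range t.length, Sat (subst φ fun r => v (t.take (j + 1), r)) b}
  let len : J → ℕ := fun j => match j with
    | Sum.inl (s, _) => s.length + 1
    | Sum.inr (t, _) => t.length
  obtain ⟨v, hv⟩ := hκ.exists_of_fip (hκ.mk_lt_of_small (List ℕ × Fin m)) hA S (by
    rintro (⟨s, t⟩ | ⟨t, s⟩)
    · exact definable_not_exists_sat A φ t.1 fun i r => (s ++ [i], r)
    · exact definable_exists_sat φ s.1 (fun ψ hψ => (params_subset_dom (s.2 hψ)).trans hp)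
        (Finset.range t.length) fun j r => (t.take (j + 1), r)) (by
    intro T
    obtain ⟨a, ha, hab⟩ := (hN (T.sup len)).exists_finite_tree
    refine ⟨fun x => a x.1 x.2, fun j hj => ?_⟩
    have hlen : len j ≤ T.sup len := Finset.le_sup hj
    rcases j with ⟨s, t⟩ | ⟨t, s⟩
    · exact ha s hlen t.1 t.2
    · exact consistent_union_iff.1 (hab t hlen) s.1 s.2 (Finset.range t.length) (by simp))
  refine ⟨fun s r => v (s, r), fun s t ht => hv (Sum.inl (s, ⟨t, ht⟩)), fun t => ?_⟩
  refine consistent_union_iff.2 fun s hs F hF => ?_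
  obtain ⟨b, hb, hbt⟩ := hv (Sum.inr (t, ⟨s, hs⟩))
  exact ⟨b, hb, fun j hj => hbt j (Finset.mem_range.2 (hF j hj))⟩

/-- Compactness again: finitely many branch conditions mention finitely many levels. Listing these
increasingly, a node at such a level is read as the list of its values at the earlier listed levels,
which is a node of the given tree. -/
theorem IsPatternTree.hasTree [Nonempty M] (hκ : IsMonster L M κ) {A : Set M} (hA : #A < κ)
    {p : Set (PFormula L M n)} (hp : dom p ⊆ A) {δ : Pattern L n} {a : List ℕ → Fin δ.1 → M}
    (ha : IsPatternTree p δ a) (α : Ordinal.{max u v}) : HasTree p α := by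
  classical
  obtain ⟨m, φ, k⟩ := δ
  let V := Σ β : Set.Iio α, (Set.Iio β.1 → ℕ) × ℕ × Fin m
  let J := (Σ β : Set.Iio α, (Set.Iio β.1 → ℕ) × {t : Finset ℕ // t.card = k}) ⊕
    ((Ordinal.{max u v} → ℕ) × {s : Finset (PFormula L M n) // (s : Set (PFormula L M n)) ⊆ p} ×
      Finset (Set.Iio α))
  let S : J → Set (V → M) := fun j => match j with
    | Sum.inl ⟨β, s, t⟩ => {v | ¬ ∃ b, ∀ i ∈ t.1, Sat (subst φ fun r => v ⟨β, s, i, r⟩) b}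
    | Sum.inr (f, s, F) => {v | ∃ b, (∀ ψ ∈ s.1, Sat ψ b) ∧
        ∀ β ∈ F, Sat (subst φ fun r => v ⟨β, fun j => f j, f β, r⟩) b}
  -- Sibling inconsistency holds at every node of the given tree, so those conditions put no demand
  -- on the enumeration of levels.
  let lvl : J → Finset (Set.Iio α) := fun j => match j with
    | Sum.inl _ => ∅
    | Sum.inr (_, _, F) => F
  obtain ⟨v, hv⟩ := hκ.exists_of_fip (hκ.mk_lt_of_small V) hA S (by
    rintro (⟨β, s, t⟩ | ⟨f, s, F⟩)
    · exact definable_not_exists_sat A φ t.1 fun i r => (⟨β, s, i, r⟩ : V)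
    · exact definable_exists_sat φ s.1 (fun ψ hψ => (params_subset_dom (s.2 hψ)).trans hp)
        F fun β r => (⟨β, fun j => f j, f β, r⟩ : V)) (by
    intro T
    obtain ⟨e, r, her⟩ := exists_enumeration ((T.biUnion lvl).image Subtype.val)
    let node : (β : Set.Iio α) → (Set.Iio β.1 → ℕ) → List ℕ := fun β s =>
      (List.range (r β)).map fun j => if h : e j < β then s ⟨e j, h⟩ else 0
    refine ⟨fun x => a (node x.1 x.2.1 ++ [x.2.2.1]) x.2.2.2, fun j hj => ?_⟩
    rcases j with ⟨β, s, t⟩ | ⟨f, s, F⟩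
    · exact ha.1 (node β s) t.1 t.2
    · have hF : ∀ β ∈ F, e (r β) = β ∧ ∀ j < r β, e j < β := fun β hβ =>
        her β (Finset.mem_image_of_mem _ (Finset.mem_biUnion.2 ⟨_, hj, hβ⟩))
      obtain ⟨b, hb⟩ := ha.consistent_path (fun j => f (e j))
        (s.1 ∪ F.image fun β : Set.Iio α =>
          subst φ (a ((List.range (r β + 1)).map fun j => f (e j)))) (by
          intro χ hχ
          simp only [Finset.coe_union, Set.mem_union, Finset.mem_coe, Finset.mem_image] at hχ
          rcases hχ with h | ⟨β, hβ, rfl⟩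
          · exact Or.inl (s.2 h)
          · exact Or.inr ⟨r β, rfl⟩)
      refine ⟨b, fun ψ hψ => hb ψ (Finset.mem_union_left _ hψ), fun β hβ => ?_⟩
      have := hb _ (Finset.mem_union_right _ (Finset.mem_image_of_mem _ hβ))
      suffices h : node β (fun j => f j) ++ [f β] = (List.range (r β + 1)).map fun j => f (e j) by
        rw [← h] at this
        exact this
      rw [List.range_succ, List.map_append, List.map_singleton, (hF β hβ).1]
      refine congrArg (· ++ [f β]) ?_
      refine List.map_congr_left fun j hj => ?_
      exact dif_pos ((hF β hβ).2 j (List.mem_range.1 hj)))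
  refine ⟨fun _ => m, fun _ => φ, fun _ => k, fun β s i r =>
    if h : β < α then v ⟨⟨β, h⟩, s, i, r⟩ else Classical.arbitrary M,
    fun β hβ s t ht => ?_, fun f => ?_⟩
  · rintro ⟨b, hb⟩
    exact hv (Sum.inl ⟨⟨β, hβ⟩, s, t, ht⟩) ⟨b, fun i hi => by simpa [hβ] using hb i hi⟩
  · refine consistent_union_iff.2 fun s hs F hF => ?_
    obtain ⟨b, hb, hbF⟩ := hv (Sum.inr (f, ⟨s, hs⟩, F.subtype (· < α)))
    refine ⟨b, hb, fun β hβ => ?_⟩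
    have := hbF ⟨β, hF β hβ⟩ (Finset.mem_subtype.2 hβ)
    simpa [hF β hβ] using this

end Constructions

/-! ### Forking sequences and chains from pattern trees -/

section Sequences

variable {L : FirstOrder.Language.{u, v}} {M : Type w} [L.Structure M] {n m : ℕ}
  {κ : Cardinal.{w}}

theorem definable_realize_iff {A : Set M} {V ι : Type*} (θ : L.Formula ((A ⊕ ι) ⊕ Fin m))
    (g : ι → V) (h h' : Fin m → V) :
    A.Definable L {v : V → M | θ.Realize (Sum.elim (Sum.elim (↑) (v ∘ g)) (v ∘ h)) ↔
      θ.Realize (Sum.elim (Sum.elim (↑) (v ∘ g)) (v ∘ h'))} := by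
  refine Set.definable_iff_exists_formula_sum.2
    ⟨(θ.relabel (Sum.elim (Sum.map id g) (Sum.inr ∘ h))).iff
      (θ.relabel (Sum.elim (Sum.map id g) (Sum.inr ∘ h'))), Set.ext fun v => ?_⟩
  simp only [Set.mem_ofPred_eq, Formula.realize_iff, Formula.realize_relabel, Sum.comp_elim,
    Sum.elim_comp_map, ← Function.comp_assoc, Sum.elim_comp_inr, Function.comp_id]

theorem divides_forks {A : Set M} {ψ : PFormula L M n} (h : Divides A ψ) : Forks A {ψ} :=
  ⟨{ψ}, by simpa using h, {ψ}, by simp, fun b hb => ⟨ψ, by simp, hb ψ (by simp)⟩⟩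

/-- The unknowns `v (i, l, ·)` are a path, at `l = 0`, together with conjugates of each entry
witnessing that it divides over `A` and the earlier path. Finitely many of the conditions "same
type" amount to a finite colouring, so `exists_homogeneous_path` satisfies them inside the given
tree. -/
theorem IsPatternTree.hasForkingSequence [Nonempty M] (hκ : IsMonster L M κ) {A : Set M}
    (hA : #A < κ) {p : Set (PFormula L M n)} (hp : dom p ⊆ A) {δ : Pattern L n}
    {a : List ℕ → Fin δ.1 → M} (ha : IsPatternTree p δ a) (α : Ordinal.{max u v}) :
    HasForkingSequence p A α := by
  classical
  obtain ⟨m, φ, k⟩ := δ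
  let V := Set.Iio α × ℕ × Fin m
  let lower : (i : Set.Iio α) → Set.Iio i.1 × Fin m → Set.Iio α × Fin m := fun i x =>
    (⟨x.1, lt_trans (Set.mem_Iio.1 x.1.2) (Set.mem_Iio.1 i.2)⟩, x.2)
  let J := (Set.Iio α × {t : Finset ℕ // t.card = k}) ⊕
    ({s : Finset (PFormula L M n) // (s : Set (PFormula L M n)) ⊆ p} × Finset (Set.Iio α)) ⊕
    (Σ i : Set.Iio α, ℕ × L.Formula ((A ⊕ (Set.Iio i.1 × Fin m)) ⊕ Fin m))
  let S : J → Set (V → M) := fun j => match j with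
    | Sum.inl (i, t) => {v | ¬ ∃ b, ∀ l ∈ t.1, Sat (subst φ fun r => v (i, l, r)) b}
    | Sum.inr (Sum.inl (s, F)) => {v | ∃ b, (∀ ψ ∈ s.1, Sat ψ b) ∧
        ∀ i ∈ F, Sat (subst φ fun r => v (i, 0, r)) b}
    | Sum.inr (Sum.inr ⟨i, l, θ⟩) => {v |
        θ.Realize (Sum.elim (Sum.elim (↑) (v ∘ fun x => ((lower i x).1, 0, x.2)))
          (v ∘ fun r => (i, 0, r))) ↔
        θ.Realize (Sum.elim (Sum.elim (↑) (v ∘ fun x => ((lower i x).1, 0, x.2)))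
          (v ∘ fun r => (i, l, r)))}
  let lvl : J → Finset (Set.Iio α) := fun j => match j with
    | Sum.inl (i, _) => {i}
    | Sum.inr (Sum.inl (_, F)) => F
    | Sum.inr (Sum.inr ⟨i, _⟩) => {i}
  -- The truth value of `θ`, recorded only at the level it belongs to; the clause `i' = i` makes the
  -- colour depend only on the path below `i`.
  let colour : J → Set.Iio α → (Set.Iio α → Fin m → M) → (Fin m → M) → Prop := fun j i b z =>
    match j with
    | Sum.inr (Sum.inr ⟨i', _, θ⟩) => i' = i ∧
        θ.Realize (Sum.elim (Sum.elim (↑) fun x => b (lower i' x).1 x.2) z)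
    | _ => True
  obtain ⟨v, hv⟩ := hκ.exists_of_fip (hκ.mk_lt_of_small V) hA S (by
    rintro (⟨i, t⟩ | ⟨s, F⟩ | ⟨i, l, θ⟩)
    · exact definable_not_exists_sat A φ t.1 fun l r => ((i, l, r) : V)
    · exact definable_exists_sat φ s.1 (fun ψ hψ => (params_subset_dom (s.2 hψ)).trans hp)
        F fun i r => ((i, 0, r) : V)
    · exact definable_realize_iff θ (fun x => (((lower i x).1, 0, x.2) : V)) _ _) (by
    intro T
    obtain ⟨t, c, htc⟩ := exists_homogeneous_path a
      (fun i b z (j : T) => colour j.1 i b z) (by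
        intro i b b' hb
        funext z
        funext ⟨j, hj⟩
        rcases j with _ | _ | ⟨i', l, θ⟩
        · rfl
        · rfl
        · refine propext (and_congr_right fun hi => ?_)
          have : (fun x => b (lower i' x).1 x.2) = fun x => b' (lower i' x).1 x.2 := by
            funext x
            rw [hb _ (by rw [← hi]; exact x.1.2)]
          rw [this]) (T.biUnion lvl)
    refine ⟨fun x => c x.1 x.2.1 x.2.2, fun j hj => ?_⟩
    have hmem : ∀ i ∈ lvl j, i ∈ T.biUnion lvl := fun i hi => Finset.mem_biUnion.2 ⟨j, hj, hi⟩
    rcases j with ⟨i, d⟩ | ⟨s, F⟩ | ⟨i, l, θ⟩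
    · obtain ⟨s, e, he, hs, -, -⟩ := htc i (hmem i (Finset.mem_singleton_self i))
      have := (ha.1 s).comp_injective he d.1 d.2
      simp only [← hs] at this
      exact this
    · choose! s' e he hs hst hG using htc
      obtain ⟨b, hb, hbF⟩ := consistent_union_iff.1 (ha.2 t) s.1 s.2
        (F.image fun i => (s' i).length) (by
          intro j hj
          obtain ⟨i, hi, rfl⟩ := Finset.mem_image.1 hj
          have := (hst i (hmem i hi)).length_le
          simp only [List.length_append, List.length_singleton] at this
          omega)
      refine ⟨b, hb, fun i hi => ?_⟩
      have := hbF _ (Finset.mem_image_of_mem _ hi)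
      have heq : t.take ((s' i).length + 1) = s' i ++ [e i 0] := by
        obtain ⟨u, hu⟩ := hst i (hmem i hi)
        rw [← hu, List.take_left' (by simp)]
      rw [heq, ← hs i (hmem i hi)] at this
      exact this
    · obtain ⟨s, e, he, hs, -, hG⟩ := htc i (hmem i (Finset.mem_singleton_self i))
      have := (congrFun (hG l) ⟨_, hj⟩).symm.to_iff
      exact (and_congr_right_iff.1 this) rfl)
  refine ⟨fun _ => m, fun _ => φ, fun i r =>
    if h : i < α then v (⟨i, h⟩, 0, r) else Classical.arbitrary M, ?_, fun i hi => ?_⟩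
  · refine consistent_union_iff.2 fun s hs F hF => ?_
    obtain ⟨b, hb, hbF⟩ := hv (Sum.inr (Sum.inl (⟨s, hs⟩, F.subtype (· < α))))
    refine ⟨b, hb, fun i hi => ?_⟩
    have := hbF ⟨i, hF i hi⟩ (Finset.mem_subtype.2 hi)
    simpa [hF i hi] using this
  · refine divides_forks ⟨m, φ, _, rfl, k, fun l r => v (⟨i, hi⟩, l, r), fun l ψ hψ => ?_,
      fun t ht => hv (Sum.inl (⟨i, hi⟩, ⟨t, ht⟩))⟩
    obtain ⟨θ, hθ⟩ := exists_formula_of_params_subset ψ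
      (Sum.elim (↑) (v ∘ fun x => ((lower ⟨i, hi⟩ x).1, 0, x.2)) : A ⊕ _ → M) (by
        intro z hz
        rcases hψ hz with h | ⟨j, hj, r, rfl⟩
        · exact ⟨Sum.inl ⟨z, h⟩, rfl⟩
        · refine ⟨Sum.inr (⟨j, hj⟩, r), ?_⟩
          simp [lower, show j < α from lt_trans hj hi])
    rw [hθ, hθ]
    simp only [dif_pos hi]
    exact hv (Sum.inr (Sum.inr ⟨⟨i, hi⟩, l, θ⟩))

/-- The complete type of `b` over `B`. -/
def typeOf (B : Set M) (b : Fin n → M) : Set (PFormula L M n) :=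
  {φ | params φ ⊆ B ∧ Sat φ b}

theorem isCompleteType_typeOf (B : Set M) (b : Fin n → M) :
    IsCompleteType B (typeOf (L := L) B b) := by
  refine ⟨⟨fun c ⟨φ, hφ, hc⟩ => hφ.1 hc, fun s hs => ⟨b, fun φ hφ => (hs hφ).2⟩⟩, fun φ hφ => ?_⟩
  by_cases h : Sat φ b
  · exact Or.inl ⟨hφ, h⟩
  · refine Or.inr ⟨?_, sat_not.2 h⟩
    have : params φ.not = params φ := by
      simp [params, BoundedFormula.freeVarFinset]
    rwa [this]

theorem dom_typeOf (B : Set M) (b : Fin n → M) : dom (typeOf (L := L) B b) = B := by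
  classical
  refine Set.Subset.antisymm (fun c ⟨φ, hφ, hc⟩ => hφ.1 hc) fun c hc => ?_
  let φ : PFormula L M n := (Term.var (Sum.inl c)).equal (Term.var (Sum.inl c))
  have h : ∀ x, x ∈ params φ ↔ x = c := by
    intro x
    simp [params, φ, Term.equal, Term.bdEqual, BoundedFormula.freeVarFinset, Term.varFinsetLeft]
  refine ⟨φ, ⟨fun x hx => (h x).1 hx ▸ hc, ?_⟩, (h c).2 rfl⟩
  simp [φ, Sat, Formula.realize_equal]

theorem typeOf_mono {B C : Set M} (h : B ⊆ C) (b : Fin n → M) :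
    typeOf (L := L) B b ⊆ typeOf C b :=
  fun _ hφ => ⟨hφ.1.trans h, hφ.2⟩

/-- The parameters of a sequence of tuples below `i`, together with `A`. -/
def paramsBelow (A : Set M) {m : Ordinal.{x} → ℕ} (a : ∀ i, Fin (m i) → M) (i : Ordinal.{x}) :
    Set M :=
  A ∪ {c | ∃ j < i, c ∈ Set.range (a j)}

theorem paramsBelow_mono (A : Set M) {m : Ordinal.{x} → ℕ} (a : ∀ i, Fin (m i) → M)
    {i j : Ordinal.{x}} (h : i ≤ j) : paramsBelow A a i ⊆ paramsBelow A a j :=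
  Set.union_subset_union_right A fun _ ⟨l, hl, hc⟩ => ⟨l, hl.trans_le h, hc⟩

theorem IsMonster.mk_paramsBelow_lt (hκ : IsMonster L M κ) {A : Set M} (hA : #A < κ)
    {m : Ordinal.{max u v} → ℕ} (a : ∀ i, Fin (m i) → M) (i : Ordinal.{max u v}) :
    #(paramsBelow A a i) < κ := by
  refine hκ.mk_union_lt hA ?_
  have h : {c | ∃ j < i, c ∈ Set.range (a j)} =
      Set.range fun x : Σ j : Set.Iio i, Fin (m j) => a x.1 x.2 := by
    ext c
    constructor
    · rintro ⟨j, hj, r, rfl⟩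
      exact ⟨⟨⟨j, hj⟩, r⟩, rfl⟩
    · rintro ⟨⟨⟨j, hj⟩, r⟩, rfl⟩
      exact ⟨j, hj, r, rfl⟩
  rw [h]
  exact mk_range_lt (hκ.mk_lt_of_small _) _

/-- One tuple `b` realizes `p` and the whole sequence; the chain consists of its types over growing
initial parts of the parameters. -/
theorem HasForkingSequence.hasForkingChain [Nonempty M] (hκ : IsMonster L M κ) {A : Set M}
    (hA : #A < κ) {p : Set (PFormula L M n)} (hp : dom p ⊆ A) {α : Ordinal.{max u v}}
    (h : HasForkingSequence p A α) : HasForkingChain κ p A α := by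
  obtain ⟨m, φ, a, hcon, hf⟩ := h
  obtain ⟨b, hb⟩ := hκ.exists_realization (hκ.mk_paramsBelow_lt hA a α) ⟨by
    rintro c ⟨ψ, hψ | ⟨i, hi, rfl⟩, hc⟩
    · exact Or.inl (hp (params_subset_dom hψ hc))
    · exact Or.inr ⟨i, hi, params_subst_subset _ _ hc⟩, hcon⟩
  -- The successor puts the `i`-th tuple itself into `B i`, so the `i`-th formula of the sequence
  -- belongs to the `i`-th type.
  let B : Ordinal.{max u v} → Set M := fun i => paramsBelow A a (Order.succ i)
  have hmem : ∀ i < α, Forks (paramsBelow A a i) (typeOf (L := L) (B i) b) := fun i hi => by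
    refine (hf i hi).mono (Set.singleton_subset_iff.2 ⟨?_, hb _ (Or.inr ⟨i, hi, rfl⟩)⟩)
    exact (params_subst_subset _ _).trans fun c hc =>
      Or.inr ⟨i, Order.lt_succ i, hc⟩
  refine ⟨fun i => typeOf (B i) b, fun i _ => ⟨B i, hκ.mk_paramsBelow_lt hA a _,
    isCompleteType_typeOf _ _⟩, fun h0 => ⟨fun ψ hψ => ⟨?_, hb ψ (Or.inl hψ)⟩, ?_, ?_⟩,
    fun i hi h0 => ⟨?_, ?_⟩⟩
  · exact ((params_subset_dom hψ).trans hp).trans Set.subset_union_left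
  · rw [dom_typeOf]
    exact Set.subset_union_left
  · have := hmem 0 h0
    rwa [paramsBelow, show {c | ∃ j < (0 : Ordinal.{max u v}), c ∈ Set.range (a j)} = ∅ by simp,
      Set.union_empty] at this
  · rintro ψ ⟨j, hj, hψ⟩
    exact typeOf_mono (paramsBelow_mono A a (Order.succ_le_succ hj.le)) b hψ
  · have hdom : dom (before (fun i => typeOf (L := L) (B i) b) i) = paramsBelow A a i := by
      refine Set.Subset.antisymm ?_ ?_
      · rintro c ⟨ψ, ⟨j, hj, hψ⟩, hc⟩
        exact paramsBelow_mono A a (Order.succ_le_of_lt hj) (hψ.1 hc)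
      · have hB : ∀ j < i, B j ⊆ dom (before (fun i => typeOf (L := L) (B i) b) i) := by
          intro j hj
          rw [← dom_typeOf (L := L) (B j) b]
          exact dom_mono fun ψ hψ => ⟨j, hj, hψ⟩
        rintro c (hc | ⟨j, hj, hc⟩)
        · exact hB 0 h0 (Or.inl hc)
        · exact hB j hj (Or.inr ⟨j, Order.lt_succ j, hc⟩)
    rw [hdom]
    exact hmem i hi

end Sequences

theorem sSup_coe_eq_top_iff {S : Set Ordinal.{x}} (hS : ∀ α ∈ S, ∀ β ≤ α, β ∈ S) :
    sSup ((fun α : Ordinal.{x} => (α : WithTop Ordinal.{x})) '' S) = ⊤ ↔ ∀ α, α ∈ S := by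
  have hlub := WithTop.isLUB_sSup ((fun α : Ordinal.{x} => (α : WithTop Ordinal.{x})) '' S)
  constructor
  · intro h α
    by_contra hα
    refine (WithTop.coe_lt_top α).not_ge (h ▸ hlub.2 ?_)
    rintro _ ⟨β, hβ, rfl⟩
    exact WithTop.coe_le_coe.2 (le_of_not_ge fun hle => hα (hS β hβ α hle))
  · intro h
    by_contra hne
    obtain ⟨α, hα⟩ := WithTop.ne_top_iff_exists.1 hne
    have := hlub.1 ⟨Order.succ α, h _, rfl⟩
    rw [← hα] at this
    exact (Order.lt_succ α).not_ge (WithTop.coe_le_coe.1 this)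

/-! ### Counting patterns -/

section Counting

variable {L : FirstOrder.Language.{u, v}} {n : ℕ}

theorem mk_pattern_le (T : L.Theory) : #(Pattern L n) ≤ cardTheory T := by
  have h (m : ℕ) : #(L.Formula (Fin m ⊕ Fin n) × ℕ) ≤ cardTheory T := by
    have h1 : #(L.Formula (Fin m ⊕ Fin n)) ≤ cardTheory T := by
      refine (mk_le_of_injective (f := fun φ => (⟨0, φ⟩ : Σ k, L.BoundedFormula (Fin m ⊕ Fin n) k))
        fun φ ψ h => by simpa using h).trans (BoundedFormula.card_le.trans ?_)
      refine max_le (le_max_left _ _) ((add_le_max _ _).trans ?_)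
      refine max_le (max_le ?_ ?_) (le_max_left _ _)
      · refine le_trans ?_ (le_max_left _ _)
        simp [(natCast_lt_aleph0).le]
      · simp [cardTheory]
    rw [mk_prod]
    refine (mul_le_mul' (lift_le.2 h1) le_rfl).trans ?_
    rw [lift_uzero, mk_nat, lift_aleph0]
    exact mul_le_of_le (le_max_left _ _) le_rfl (le_max_left _ _)
  rw [Pattern, mk_sigma]
  refine (sum_le_sum _ (fun _ => cardTheory T) h).trans ?_
  rw [sum_const, mk_nat, lift_aleph0, lift_id']
  exact mul_le_of_le (le_max_left _ _) (le_max_left _ _) le_rfl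

/-- Infinite repetition is all that is needed, as only finite ranks have to be built. The ordinals
below `|T|⁺` are counted through `Shrink` because they live one universe up. -/
theorem exists_infinite_fiber_of_card_le (T : L.Theory) {X : Type max u v} [Infinite X]
    (hX : #X ≤ cardTheory T) (g : Ordinal.{max u v} → X) :
    ∃ y, {i | i < (Order.succ (cardTheory T)).ord ∧ g i = y}.Infinite := by
  let α := (Order.succ (cardTheory T)).ord
  have hα : #(Shrink.{max u v} (Set.Iio α)) = Order.succ (cardTheory T) := by
    have h1 : Cardinal.lift.{max u v + 1} #(Shrink.{max u v} (Set.Iio α)) =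
        Cardinal.lift.{max u v} #(Set.Iio α) :=
      (mk_congr_lift (equivShrink.{max u v} (Set.Iio α))).symm
    rw [mk_Iio_ordinal, lift_id'.{max u v, max u v + 1}, lift_inj] at h1
    rw [h1, card_ord]
  obtain ⟨y, hy⟩ := exists_infinite_fiber'
    (fun i : Shrink.{max u v} (Set.Iio α) => g ((equivShrink (Set.Iio α)).symm i).1)
    (hα ▸ Order.lt_succ_iff.2 hX)
  refine ⟨y, ?_⟩
  have : Set.Infinite (Set.range fun i : (fun i : Shrink.{max u v} (Set.Iio α) =>
      g ((equivShrink (Set.Iio α)).symm i).1) ⁻¹' {y} => ((equivShrink (Set.Iio α)).symm i.1).1) :=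
    Set.infinite_range_of_injective (Subtype.val_injective.comp
      ((equivShrink (Set.Iio α)).symm.injective.comp Subtype.val_injective))
  refine this.mono ?_
  rintro _ ⟨i, rfl⟩
  exact ⟨((equivShrink (Set.Iio α)).symm i.1).2, i.2⟩

instance : Infinite (Pattern L n) :=
  Infinite.of_injective (fun k : ℕ => (⟨0, ⊥, k⟩ : Pattern L n)) fun k l h => by simpa using h

end Counting

theorem union_instances_subset {X J : Type*} {p : Set X} {P Q : J → Prop} {e : J → X}
    (h : ∀ j, P j → Q j) : p ∪ {ψ | ∃ j, P j ∧ ψ = e j} ⊆ p ∪ {ψ | ∃ j, Q j ∧ ψ = e j} :=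
  Set.union_subset_union_right p fun _ hψ => hψ.imp fun j hj => ⟨h j hj.1, hj.2⟩

/-! ### Unbounded rank from long chains, sequences and trees -/

section Main

variable {L : FirstOrder.Language.{u, v}} {M : Type w} [L.Structure M] {n m : ℕ}
  {κ : Cardinal.{w}}

/-- An increasing sequence of length `|T|⁺` of consistent types that fork over the parameters of
the earlier ones has unbounded rank for some pattern. -/
theorem IsMonster.exists_unbounded_of_increasing (hκ : IsMonster L M κ) (T : L.Theory)
    (q : Ordinal.{max u v} → Set (PFormula L M n))
    (hmono : ∀ i < (Order.succ (cardTheory T)).ord, ∀ j < i, q j ⊆ q i)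
    (hcon : ∀ i < (Order.succ (cardTheory T)).ord, Consistent (q i))
    (hf : ∀ i < (Order.succ (cardTheory T)).ord, 0 < i →
      ∃ B : Set M, #B < κ ∧ dom (before q i) ⊆ B ∧ Forks B (q i)) :
    ∃ δ, ∀ N, TreeRank {δ} N (q 0) := by
  classical
  have hΔ : ∀ i, ∃ Δ : Finset (Pattern L n), i < (Order.succ (cardTheory T)).ord → 0 < i →
      ∀ N, TreeRank (Δ : Set (Pattern L n)) N (q i) →
        TreeRank (Δ : Set (Pattern L n)) (N + 1) (before q i) := by
    intro i
    by_cases h : i < (Order.succ (cardTheory T)).ord ∧ 0 < i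
    · obtain ⟨B, hB, hdom, hfB⟩ := hf i h.1 h.2
      obtain ⟨Δ, hΔ⟩ := hκ.exists_treeRank_succ hB hdom
        (fun ψ ⟨j, hj, hψ⟩ => hmono i h.1 j hj hψ) hfB
      exact ⟨Δ, fun _ _ => hΔ⟩
    · exact ⟨∅, fun h1 h2 => (h ⟨h1, h2⟩).elim⟩
  choose g hg using hΔ
  obtain ⟨Δ, hΔ⟩ := exists_infinite_fiber_of_card_le T
    ((mk_finset_of_infinite (Pattern L n)).trans_le (mk_pattern_le T)) g
  refine exists_single_unbounded (Δ := Δ) fun N => ?_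
  -- The index `0` is discarded, since nothing is assumed about forking there.
  obtain ⟨F, hF, hFN⟩ := (hΔ.sdiff (Set.finite_singleton 0)).exists_subset_card_eq N
  -- Descending through `F`, each index contributes one to the rank of every type before it.
  suffices h : ∀ F : Finset Ordinal.{max u v}, (∀ i ∈ F, i < (Order.succ (cardTheory T)).ord ∧
      g i = Δ) → ∀ j < (Order.succ (cardTheory T)).ord, (∀ i ∈ F, j < i) →
      TreeRank (Δ : Set (Pattern L n)) F.card (q j) by
    rw [← hFN]
    refine h F (fun i hi => (hF hi).1) 0 ?_ fun i hi => pos_iff_ne_zero.2 (hF hi).2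
    obtain ⟨i, hi⟩ := hΔ.nonempty
    exact zero_le.trans_lt hi.1
  intro F
  induction F using Finset.induction_on_min with
  | empty => exact fun _ j hj _ => hcon j hj
  | insert i F hi ih =>
    intro hF j hj hji
    have hiF := hF i (Finset.mem_insert_self i F)
    have hlt := hji i (Finset.mem_insert_self i F)
    rw [Finset.card_insert_of_notMem fun h => (hi i h).false]
    have := ih (fun l hl => hF l (Finset.mem_insert_of_mem hl)) i hiF.1 hi
    rw [← hiF.2] at this ⊢
    exact (hg i hiF.1 (zero_le.trans_lt hlt) _ this).mono
      (subset_before hlt)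

theorem HasForkingChain.exists_unbounded (hκ : IsMonster L M κ) (T : L.Theory)
    {p : Set (PFormula L M n)} {A : Set M}
    (h : HasForkingChain κ p A (Order.succ (cardTheory T)).ord) :
    ∃ δ, ∀ N, TreeRank {δ} N p := by
  obtain ⟨q, hq, h0, hf⟩ := h
  have hpos : 0 < (Order.succ (cardTheory T)).ord := by
    rw [Cardinal.lt_ord, Ordinal.card_zero]
    exact Order.bot_lt_succ _
  have hmono : ∀ i < (Order.succ (cardTheory T)).ord, ∀ j < i, q j ⊆ q i := fun i hi j hj ψ hψ =>
    (hf i hi (zero_le.trans_lt hj)).1 ⟨j, hj, hψ⟩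
  obtain ⟨δ, hδ⟩ := hκ.exists_unbounded_of_increasing T q hmono
    (fun i hi => let ⟨_, _, hB⟩ := hq i hi; hB.1.2) fun i hi hi0 => by
      obtain ⟨B, hB, hqB⟩ := hq i hi
      exact ⟨dom (before q i), (mk_le_mk_of_subset
        ((dom_mono (hf i hi hi0).1).trans hqB.1.1)).trans_lt hB, subset_rfl, (hf i hi hi0).2⟩
  exact ⟨δ, fun N => (hδ N).mono (h0 hpos).1⟩

theorem HasForkingSequence.exists_unbounded (hκ : IsMonster L M κ) (T : L.Theory)
    {p : Set (PFormula L M n)} {A : Set M} (hA : #A < κ) (hp : dom p ⊆ A)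
    (h : HasForkingSequence p A (Order.succ (cardTheory T)).ord) :
    ∃ δ, ∀ N, TreeRank {δ} N p := by
  obtain ⟨m, φ, a, hcon, hf⟩ := h
  obtain ⟨δ, hδ⟩ := hκ.exists_unbounded_of_increasing T
    -- With `j ≤ i`, the `i`-th type contains the formula that forks over the parameters of the
    -- earlier ones.
    (fun i => p ∪ {ψ | ∃ j ≤ i, ψ = subst (φ j) (a j)})
    (fun i _ j hj => union_instances_subset fun l hl => hl.trans hj.le)
    (fun i hi => hcon.mono (union_instances_subset fun l hl => hl.trans_lt hi))
    fun i hi _ => by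
      refine ⟨paramsBelow A a i, hκ.mk_paramsBelow_lt hA a i, ?_, (hf i hi).mono ?_⟩
      · rintro c ⟨ψ, ⟨j, hj, hψ | ⟨l, hl, rfl⟩⟩, hc⟩
        · exact Or.inl (hp (params_subset_dom hψ hc))
        · exact Or.inr ⟨l, hl.trans_lt hj, params_subst_subset _ _ hc⟩
      · exact Set.singleton_subset_iff.2 (Or.inr ⟨i, le_rfl, rfl⟩)
  exact ⟨δ, fun N => (hδ N).mono Set.subset_union_left⟩

theorem HasTree.exists_unbounded (T : L.Theory) {p : Set (PFormula L M n)}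
    (h : HasTree p (Order.succ (cardTheory T)).ord) : ∃ δ, ∀ N, TreeRank {δ} N p := by
  classical
  obtain ⟨m, φ, k, a, hk, hcon⟩ := h
  obtain ⟨δ, hδ⟩ := exists_infinite_fiber_of_card_le T (mk_pattern_le T)
    fun i => (⟨m i, φ i, k i⟩ : Pattern L n)
  refine ⟨δ, fun N => ?_⟩
  obtain ⟨F, hF, hFN⟩ := hδ.exists_subset_card_eq N
  -- The branch `f` is committed below `j` only. Branching happens at the levels in `F`; at all
  -- other levels the tree just follows `f`.
  suffices h : ∀ F : Finset Ordinal.{max u v}, (∀ i ∈ F, i < (Order.succ (cardTheory T)).ord ∧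
      (⟨m i, φ i, k i⟩ : Pattern L n) = δ) → ∀ (f : Ordinal.{max u v} → ℕ),
      ∀ j ≤ (Order.succ (cardTheory T)).ord, (∀ i ∈ F, j ≤ i) → TreeRank {δ} F.card
        (p ∪ {ψ | ∃ β < j, ψ = subst (φ β) (a β (fun l => f l) (f β))}) by
    rw [← hFN]
    exact (h F hF (fun _ => 0) 0 zero_le fun i _ => zero_le).mono
      Set.subset_union_left
  intro F
  induction F using Finset.induction_on_min with
  | empty =>
    exact fun _ f j hj _ => (hcon f).mono
      (union_instances_subset fun l hl => hl.trans_le hj)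
  | insert i F hi ih =>
    intro hF f j hj hji
    have hiF := hF i (Finset.mem_insert_self i F)
    have hle := hji i (Finset.mem_insert_self i F)
    rw [Finset.card_insert_of_notMem fun h => (hi i h).false]
    -- Changing `f` at `i` selects the `l`-th sibling there and leaves every formula of a lower
    -- level unchanged.
    have hind := fun l => ih (fun l hl => hF l (Finset.mem_insert_of_mem hl))
      (Function.update f i l) (Order.succ i) (Order.succ_le_of_lt hiF.1)
      fun i' hi' => Order.succ_le_of_lt (hi i' hi')
    have hf : ∀ l, ∀ β ≤ i, (fun x : Set.Iio β => Function.update f i l x) =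
        fun x : Set.Iio β => f x :=
      fun l β hβ => funext fun x => Function.update_of_ne
        (lt_of_lt_of_le (Set.mem_Iio.1 x.2) hβ).ne _ _
    refine ⟨⟨m i, φ i, k i⟩, hiF.2, a i fun l => f l, hk i hiF.1 _, fun l => (hind l).mono ?_⟩
    rintro ψ ((hψ | ⟨β, hβ, rfl⟩) | rfl)
    · exact Or.inl hψ
    · have hβi : β < i := hβ.trans_le hle
      exact Or.inr ⟨β, hβi.trans (Order.lt_succ i), by
        rw [hf l β hβi.le, Function.update_of_ne hβi.ne]⟩
    · exact Or.inr ⟨i, Order.lt_succ i, by rw [hf l i le_rfl, Function.update_self]⟩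

theorem HasTree.of_le {p : Set (PFormula L M n)} {α β : Ordinal.{max u v}} (h : HasTree p α)
    (hβ : β ≤ α) : HasTree p β :=
  let ⟨m, φ, k, a, hk, hcon⟩ := h
  ⟨m, φ, k, a, fun γ hγ => hk γ (hγ.trans_le hβ), fun f => (hcon f).mono
    (union_instances_subset fun _ hγ => hγ.trans_le hβ)⟩

theorem HasForkingSequence.of_le {p : Set (PFormula L M n)} {A : Set M} {α β : Ordinal.{max u v}}
    (h : HasForkingSequence p A α) (hβ : β ≤ α) : HasForkingSequence p A β :=
  let ⟨m, φ, a, hcon, hf⟩ := h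
  ⟨m, φ, a, hcon.mono (union_instances_subset fun _ hγ => hγ.trans_le hβ),
    fun γ hγ => hf γ (hγ.trans_le hβ)⟩

theorem DD_eq_top_iff {p : Set (PFormula L M n)} : DD p = ⊤ ↔ ∀ α, HasTree p α :=
  sSup_coe_eq_top_iff fun _ hα _ hβ => HasTree.of_le hα hβ

theorem FD_eq_top_iff {p : Set (PFormula L M n)} {A : Set M} :
    FD p A = ⊤ ↔ ∀ α, HasForkingSequence p A α :=
  sSup_coe_eq_top_iff fun _ hα _ hβ => HasForkingSequence.of_le hα hβ

end Main

end ForkingDepth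

theorem proposition3p6 {L : FirstOrder.Language.{u, v}} (T : L.Theory)
    (hT : T.IsComplete) {M : Type w} [L.Structure M] [Nonempty M] (hM : M ⊨ T)
    (κ : Cardinal.{w}) (hκ : ForkingDepth.IsMonster L M κ)
    {n : ℕ} (A : Set M) (hA : Cardinal.mk A < κ)
    (p : Set (ForkingDepth.PFormula L M n)) (hp : ForkingDepth.IsPartialType A p) :
    (ForkingDepth.DD p < ⊤ ↔ ForkingDepth.IsSimpleType p) ∧
    (ForkingDepth.DD p < ⊤ ↔
      ¬ ForkingDepth.HasForkingChain κ p A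
        (Order.succ (ForkingDepth.cardTheory T)).ord) ∧
    (ForkingDepth.FD p A = ⊤ ↔ ForkingDepth.DD p = ⊤) := by
  open ForkingDepth in
  have hsimple : (∃ δ, ∀ N, TreeRank {δ} N p) → ¬ IsSimpleType p := fun ⟨δ, hδ⟩ =>
    not_isSimpleType_iff.2 ⟨δ, hκ.exists_patternTree hA hp.1 hδ⟩
  have hDD : DD p = ⊤ ↔ ¬ IsSimpleType p := by
    rw [DD_eq_top_iff]
    refine ⟨fun h => hsimple ((h _).exists_unbounded T), fun h α => ?_⟩
    obtain ⟨δ, a, ha⟩ := not_isSimpleType_iff.1 h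
    exact ha.hasTree hκ hA hp.1 α
  have hFD : FD p A = ⊤ ↔ ¬ IsSimpleType p := by
    rw [FD_eq_top_iff]
    refine ⟨fun h => hsimple ((h _).exists_unbounded hκ T hA hp.1), fun h α => ?_⟩
    obtain ⟨δ, a, ha⟩ := not_isSimpleType_iff.1 h
    exact ha.hasForkingSequence hκ hA hp.1 α
  have hchain : HasForkingChain κ p A (Order.succ (cardTheory T)).ord ↔ ¬ IsSimpleType p := by
    refine ⟨fun h => hsimple (h.exists_unbounded hκ T), fun h => ?_⟩
    obtain ⟨δ, a, ha⟩ := not_isSimpleType_iff.1 h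
    exact (ha.hasForkingSequence hκ hA hp.1 _).hasForkingChain hκ hA hp.1
  rw [hchain, hFD, hDD, lt_top_iff_ne_top, Ne, hDD, not_not]
  exact ⟨Iff.rfl, Iff.rfl, Iff.rfl⟩
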